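/- Let $X$ be a finite set and consider a symmetric Markov chain on $X$ with exponential holding times: a measure $\lambda_x>0$, a sub-stochastic matrix $P$ with $P^x_x=0$ and $\lambda_xP^x_y=\lambda_yP^y_x$, and jump rates $q_x>0$; the generator is $L^x_y=q_x(P^x_y-\delta^x_y)$. Put $m_x=\lambda_x/q_x$, $C_{x,y}=\lambda_xP^x_y$, $\kappa_x=\lambda_x(1-\sum_yP^x_y)$ and $e(z)=\tfrac12\sum_{x,y}C_{x,y}|z^x-z^y|^2+\sum_x\kappa_x|z^x|^2$. Assume there is $\varepsilon>0$ with $e(z)\ge\varepsilon\sum_xm_x|z^x|^2$ for all $z\in\mathbb C^X$, and let $G=(M_\lambda-C)^{-1}$ be the Green function, where $M_\lambda$ is the diagonal matrix with entries $\lambda_x$. For $t>0$ let $\mathbb P^{x,y}_t$ be the (non-normalized) law of the paths of duration $t$ of the chain started at $x$, restricted to the event that the chain is at $y$ at time $t$. The bridge measure is $\mu^{x,y}=\frac1{m_y}\int_0^\infty\mathbb P^{x,y}_t\,dt$. The loop measure $\mu$ is the image of the measure $\mu_0=\sum_{x}\int_0^\infty\frac1t\,\mathbb P^{x,x}_t\,dt$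 on based loops under the quotient map to loops (based loops up to time shift). The occupation field of a path $\gamma$ of duration $T$ is $\widehat\gamma^{\,x}=\frac1{m_x}\int_0^T1_{\{\gamma(s)=x\}}\,ds$, and that of a loop $l$, denoted $\widehat l$, is defined in the same way. Let $\mathcal L_1$ be a Poisson process of loops with intensity $\mu$ and $\widehat{\mathcal L}_1=\sum_{l\in\mathcal L_1}\widehat l$. Let $\phi=(\phi^x)_{x\in X}$ be the centered circular complex Gaussian field with $\mathbb E_\phi(\phi^x\overline{\phi}^{\,y})=2G^{x,y}$ and $\mathbb E_\phi(\phi^x\phi^y)=0$. Then: a) The fields $\widehat{\mathcal L}_1$ and $\tfrac12\phi\overline\phi=(\tfrac12|\phi^x|^2)_{x\in X}$ have the same distribution. b) For all $x,y\in X$ and every measurable complex-valued functional $F$ of a non-negative field on $X$ such that $\phi^x\overline\phi^{\,y}F(\tfrac12\phi\overline\phi)$ is integrable, $F(\widehat{\mathcal L}_1+\widehat\gamma)$ is integrable for the product of $\mu^{x,y}(d\gamma)$ and the law of $\mathcal L_1$, and $$\mathbb E_\phi\Big(\tfrac12\,\phi^x\overline\phi^{\,y}\,F\big(\tfrac12\phi\overline\phi\big)\Big)=\int\mathbb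 E\big(F(\widehat{\mathcal L}_1+\widehat\gamma)\big)\,\mu^{x,y}(d\gamma).$$ -/

import Mathlib

open MeasureTheory ProbabilityTheory
open scoped ENNReal NNReal ComplexConjugate

noncomputable section

/-! ### Paths and loops with finitely many jumps -/

/-- A discrete path: the successive states `w 0, w 1, …, w n` of a path with `n` jumps. -/
abbrev DiscretePath (X : Type*) : Type _ := Σ n : ℕ, (Fin (n + 1) → X)

namespace DiscretePath

variable {X : Type*}

/-- The initial state. -/
def first (w : DiscretePath X) : X := w.2 0

/-- The final state. -/
def last (w : DiscretePath X) : X := w.2 (Fin.last w.1)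

end DiscretePath

/-- A path of finite duration: a discrete path `w 0, …, w n` together with positive holding times
`s 0, …, s n` (the last one being the time elapsed between the last jump and the end). The discrete
path carries the discrete σ-algebra, the holding times the Borel one. -/
abbrev ChainPath (X : Type*) : Type _ :=
  Σ w : DiscretePath X, (Fin (w.1 + 1) → Set.Ioi (0 : ℝ))

namespace ChainPath

variable {X : Type*}

/-- The initial state. -/
def first (γ : ChainPath X) : X := γ.1.first

/-- The final state. -/
def last (γ : ChainPath X) : X := γ.1.last

/-- The duration `T`: the sum of the holding times. -/
def duration (γ : ChainPath X) : ℝ := ∑ i, (γ.2 i : ℝ)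

theorem duration_pos (γ : ChainPath X) : 0 < γ.duration :=
  Finset.sum_pos (fun i _ => (γ.2 i).2) Finset.univ_nonempty

/-- The time of the `k`-th jump (`k = 0` is the first jump). -/
def jumpTime (γ : ChainPath X) (k : Fin γ.1.1) : ℝ :=
  ∑ i : Fin (γ.1.1 + 1), if (i : ℕ) ≤ k then (γ.2 i : ℝ) else 0

open Classical in
/-- The number of jumps that have occurred up to time `t`. -/
def jumpsUpTo (γ : ChainPath X) (t : ℝ) : ℕ :=
  (Finset.univ.filter (fun k : Fin γ.1.1 => γ.jumpTime k ≤ t)).card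

theorem jumpsUpTo_lt (γ : ChainPath X) (t : ℝ) : γ.jumpsUpTo t < γ.1.1 + 1 :=
  Nat.lt_succ_of_le ((Finset.card_le_univ _).trans (Fintype.card_fin _).le)

/-- The state `γ(t)` of the path at time `t ∈ [0, T)`. -/
def stateAt (γ : ChainPath X) (t : ℝ) : X := γ.1.2 ⟨γ.jumpsUpTo t, γ.jumpsUpTo_lt t⟩

end ChainPath

/-- A based loop: a path whose final state is its initial state. -/
abbrev BasedLoop (X : Type*) : Type _ := {γ : ChainPath X // γ.first = γ.last}

namespace BasedLoop

variable {X : Type*}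

/-- The time period `T` of a based loop. -/
def period (l : BasedLoop X) : ℝ := l.1.duration

theorem period_pos (l : BasedLoop X) : 0 < l.period := l.1.duration_pos

/-- The `T`-periodic trajectory `ℝ → X` of a based loop of period `T`. -/
def traj (l : BasedLoop X) (t : ℝ) : X := l.1.stateAt (toIcoMod l.period_pos 0 t)

/-- Two based loops are equivalent when one is a time shift of the other. -/
def shiftSetoid (X : Type*) : Setoid (BasedLoop X) where
  r l l' := l.period = l'.period ∧ ∃ s : ℝ, ∀ t : ℝ, l'.traj t = l.traj (t + s)
  iseqv :=
    { refl := fun l => ⟨rfl, 0, fun t => by rw [add_zero]⟩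
      symm := by
        rintro l l' ⟨hT, s, hs⟩
        exact ⟨hT.symm, -s, fun t => by rw [hs, neg_add_cancel_right]⟩
      trans := by
        rintro l l' l'' ⟨hT, s, hs⟩ ⟨hT', s', hs'⟩
        exact ⟨hT.trans hT', s' + s, fun t => by rw [hs', hs, add_assoc]⟩ }

end BasedLoop

/-- A loop: an equivalence class of based loops under time shifts. Loops carry the quotient
σ-algebra: a set of loops is measurable when the set of based loops representing them is. -/
abbrev Loop (X : Type*) : Type _ := Quotient (BasedLoop.shiftSetoid X)

/-! ### Occupation fields -/

/-- The time spent at `x` during `[0, T)` by a trajectory `f`. -/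
def timeSpent {X : Type*} (f : ℝ → X) (T : ℝ) (x : X) : ℝ≥0∞ :=
  ∫⁻ t in Set.Ico 0 T, Set.indicator {x} 1 (f t)

theorem timeSpent_shift {X : Type*} {f : ℝ → X} {T : ℝ} (hT : 0 < T)
    (hf : ∀ t, f (t + T) = f t) (s : ℝ) (x : X) :
    timeSpent (fun t => f (t + s)) T x = timeSpent f T x := by
  have hper : Function.Periodic f T := hf
  have h1 : timeSpent (fun t => f (t + s)) T x
      = ∫⁻ t in Set.Ioc s (s + T), Set.indicator {x} (1 : X → ℝ≥0∞) (f t) := by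
    unfold timeSpent
    rw [setLIntegral_congr (Ico_ae_eq_Ioc (μ := volume))]
    have hmp := measurePreserving_add_right (volume : Measure ℝ) s
    have he := MeasurableEquiv.measurableEmbedding (MeasurableEquiv.addRight s)
    have h := hmp.setLIntegral_comp_preimage_emb he
      (fun t => Set.indicator {x} (1 : X → ℝ≥0∞) (f t)) (Set.Ioc s (s + T))
    have hset : (fun t : ℝ => t + s) ⁻¹' Set.Ioc s (s + T) = Set.Ioc 0 T := by
      ext t
      simp only [Set.mem_preimage, Set.mem_Ioc]
      constructor <;> rintro ⟨h1, h2⟩ <;> constructor <;> linarith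
    rw [hset] at h
    exact h
  have h2 : timeSpent f T x
      = ∫⁻ t in Set.Ioc 0 (0 + T), Set.indicator {x} (1 : X → ℝ≥0∞) (f t) := by
    unfold timeSpent
    rw [setLIntegral_congr (Ico_ae_eq_Ioc (μ := volume)), zero_add]
  rw [h1, h2]
  refine (isAddFundamentalDomain_Ioc hT s).setLIntegral_eq (isAddFundamentalDomain_Ioc hT 0) _ ?_
  rintro ⟨g, hg⟩ t
  obtain ⟨n, rfl⟩ := AddSubgroup.mem_zmultiples_iff.1 hg
  have : f (n • T + t) = f t := by rw [add_comm]; exact hper.zsmul n t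
  exact congrArg (Set.indicator {x} (1 : X → ℝ≥0∞)) this

theorem BasedLoop.traj_add_period {X : Type*} (l : BasedLoop X) (t : ℝ) :
    l.traj (t + l.period) = l.traj t := by
  unfold BasedLoop.traj
  rw [toIcoMod_add_right]

/-- The time spent by a loop at `x` over one period. -/
def Loop.timeSpent {X : Type*} (l : Loop X) (x : X) : ℝ≥0∞ :=
  Quotient.lift (fun b : BasedLoop X => _root_.timeSpent b.traj b.period x)
    (by
      rintro l l' ⟨hT, s, hs⟩
      have h : l'.traj = fun t => l.traj (t + s) := funext hs
      change _root_.timeSpent l.traj l.period x = _root_.timeSpent l'.traj l'.period x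
      rw [h, ← hT]
      exact (timeSpent_shift l.period_pos l.traj_add_period s x).symm) l

/-! ### Symmetric Markov chains on a finite space -/

/-- A symmetric continuous-time Markov chain on a finite space `X`: it waits at `x` an exponential
time of parameter `q x`, then jumps to `y` with probability `P x y` or is killed with
the remaining probability; `P` is symmetric with respect to the positive measure `lam`. -/
structure SymmetricChain (X : Type*) [Fintype X] where
  /-- the reversible measure `λ` of the jump matrix -/
  lam : X → ℝ
  /-- the (sub-stochastic) jump matrix -/
  P : X → X → ℝ
  /-- the jump rates -/
  q : X → ℝ
  lam_pos : ∀ x, 0 < lam x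
  P_nonneg : ∀ x y, 0 ≤ P x y
  P_sum_le_one : ∀ x, ∑ y, P x y ≤ 1
  P_diag : ∀ x, P x x = 0
  P_symm : ∀ x y, lam x * P x y = lam y * P y x
  q_pos : ∀ x, 0 < q x

namespace SymmetricChain

variable {X : Type*} [Fintype X] (M : SymmetricChain X)

/-- The conductances `C_{x,y} = λ_x P^x_y`. -/
def conductance (x y : X) : ℝ := M.lam x * M.P x y

/-- The killing measure `κ_x = λ_x (1 - ∑_y P^x_y)`. -/
def kill (x : X) : ℝ := M.lam x * (1 - ∑ y, M.P x y)

/-- The measure `m_x = λ_x / q_x`, which is reversible for the generator `q (P - I)`. -/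
def m (x : X) : ℝ := M.lam x / M.q x

/-- The energy `e(z) = ½ ∑ C_{x,y} |z^x - z^y|² + ∑ κ_x |z^x|²`. -/
def energy (z : X → ℂ) : ℝ :=
  1 / 2 * ∑ x, ∑ y, M.conductance x y * ‖z x - z y‖ ^ 2 + ∑ x, M.kill x * ‖z x‖ ^ 2

/-- The mass gap: for some `ε > 0` the energy dominates `ε` times the squared norm of `L²(m)`. -/
def MassGap : Prop :=
  ∃ ε : ℝ, 0 < ε ∧ ∀ z : X → ℂ, ε * ∑ x, M.m x * ‖z x‖ ^ 2 ≤ M.energy z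

/-- The Green function `G = (M_λ - C)⁻¹`. -/
def green [DecidableEq X] : Matrix X X ℝ :=
  (Matrix.diagonal M.lam - Matrix.of M.conductance)⁻¹

/-- The weight `∏ q_{w_i} P^{w_i}_{w_{i+1}}` of the jumps of a discrete path. -/
def jumpWeight (w : DiscretePath X) : ℝ :=
  ∏ i : Fin w.1, M.q (w.2 i.castSucc) * M.P (w.2 i.castSucc) (w.2 i.succ)

/-- The measure on the holding times along a discrete path `w` with `n` jumps:
`∏_{i<n} q_{w_i} P^{w_i}_{w_{i+1}} · ∏_{i≤n} e^{- q_{w_i} s_i} ds_i`. -/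
def holdingMeasure (w : DiscretePath X) : Measure (Fin (w.1 + 1) → Set.Ioi (0 : ℝ)) :=
  ENNReal.ofReal (M.jumpWeight w) •
    Measure.pi (fun i =>
      ((volume : Measure ℝ).comap (Subtype.val : Set.Ioi (0 : ℝ) → ℝ)).withDensity
        (fun s => ENNReal.ofReal (Real.exp (-(M.q (w.2 i) * (s : ℝ))))))

/-- The measure `∫₀^∞ ℙ_t^{x,y} dt` on paths, where `ℙ_t^{x,y}` is the non-normalized law of the
chain started at `x` and observed on `[0, t]`, restricted to the event that it is at `y` at time
`t`. In terms of the `n` jump times `t_1 < … < t_n < t`, the measure `ℙ_t^{x,y}` has density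
`∏ P^{w_i}_{w_{i+1}} q_{w_i} e^{-q_{w_i} (t_{i+1} - t_i)} · e^{-q_y (t - t_n)}` on the discrete
paths `w` from `x` to `y`; `dt_1 ⋯ dt_n dt` is the Lebesgue measure in the `n + 1` holding times. -/
def pathMeasure (x y : X) : Measure (ChainPath X) :=
  Measure.sum (fun w : {w : DiscretePath X // w.first = x ∧ w.last = y} =>
    (M.holdingMeasure w.1).map (Sigma.mk w.1))

/-- The bridge measure `μ^{x,y} = (1 / m_y) ∫₀^∞ ℙ_t^{x,y} dt`. -/
def bridgeMeasure (x y : X) : Measure (ChainPath X) :=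
  (ENNReal.ofReal (M.m y))⁻¹ • M.pathMeasure x y

/-- The measure `μ₀ = ∑_x ∫₀^∞ (1 / t) ℙ_t^{x,x} dt` on based loops. -/
def basedLoopMeasure : Measure (BasedLoop X) :=
  ((∑ x, M.pathMeasure x x).comap (Subtype.val : BasedLoop X → ChainPath X)).withDensity
    (fun l : BasedLoop X => (ENNReal.ofReal l.period)⁻¹)

/-- The loop measure `μ`: the measure on loops induced by `μ₀`. -/
def loopMeasure : Measure (Loop X) :=
  M.basedLoopMeasure.map (Quotient.mk (BasedLoop.shiftSetoid X))

/-- The occupation field `γ̂^x = (1 / m_x) ∫₀^T 1_{γ(s) = x} ds` of a path. -/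
def pathOccupation (γ : ChainPath X) (x : X) : ℝ≥0∞ :=
  timeSpent γ.stateAt γ.duration x / ENNReal.ofReal (M.m x)

/-- The occupation field `l̂^x = (1 / m_x) ∫₀^T 1_{l(s) = x} ds` of a loop. -/
def loopOccupation (l : Loop X) (x : X) : ℝ≥0∞ :=
  l.timeSpent x / ENNReal.ofReal (M.m x)

/-- The occupation field `∑_{l ∈ ℒ} l̂^x` of a collection of loops `ℒ`, given as a sum of Dirac
masses. -/
def soupOccupation (ℒ : Measure (Loop X)) (x : X) : ℝ≥0∞ :=
  ∫⁻ l, M.loopOccupation l x ∂ℒ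

/-- `φ` is the centered (circular) complex Gaussian field with `E(φ^x φ̄^y) = 2 G^{x,y}`. -/
structure IsGaussianField [DecidableEq X] {Ω : Type*} [MeasurableSpace Ω]
    (φ : Ω → X → ℂ) (Pr : Measure Ω) : Prop where
  gaussian : HasGaussianLaw φ Pr
  mean_zero : ∀ x, ∫ ω, φ ω x ∂Pr = 0
  circular : ∀ x y, ∫ ω, φ ω x * φ ω y ∂Pr = 0
  covariance : ∀ x y, ∫ ω, φ ω x * conj (φ ω y) ∂Pr = 2 * (M.green x y : ℂ)

end SymmetricChain

/-! ### Poisson processes -/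

/-- `N` is a Poisson point process on `E` with intensity `ν`: a random countable collection of
points of `E`, identified with the sum of the Dirac masses at these points, such that the number of
points in a measurable set `A` is Poisson of parameter `ν A` (infinite if `ν A = ∞`) and the numbers
of points in disjoint measurable sets are independent. -/
structure IsPoissonProcess {Ω E : Type*} [MeasurableSpace Ω] [MeasurableSpace E]
    (N : Ω → Measure E) (ν : Measure E) (Pr : Measure Ω) : Prop where
  measurable : Measurable N
  atomic : ∀ᵐ ω ∂Pr, ∃ (J : Set ℕ) (p : J → E), N ω = Measure.sum (fun j => Measure.dirac (p j))
  poisson : ∀ A : Set E, MeasurableSet A → ν A ≠ ∞ →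
    Pr.map (fun ω => N ω A) = (poissonMeasure (ν A).toNNReal).map (fun n : ℕ => (n : ℝ≥0∞))
  infinite : ∀ A : Set E, MeasurableSet A → ν A = ∞ → ∀ᵐ ω ∂Pr, N ω A = ∞
  indep : ∀ (k : ℕ) (A : Fin k → Set E), (∀ i, MeasurableSet (A i)) →
    Pairwise (fun i j => Disjoint (A i) (A j)) → iIndepFun (fun i ω => N ω (A i)) Pr

end

/-! Both statements are proved by comparing Laplace transforms in the field variables. For θ ≥ 0 put
A_θ = M_λ + M_θ - C (`killedLaplacian`), which the mass gap makes positive definite; G is the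
inverse of A_0.

Bridges. Along a discrete path the occupation field is linear in the holding times, so the
exponential factorizes and each visit to u contributes (q_u + θ_u/m_u)⁻¹. Summing over discrete
paths gives the Neumann series of a resolvent, and the transform of μ^{x,y} is (A_θ⁻¹)^{x,y}
(`MassGap.lintegral_bridgeMeasure`).

Loops. Writing 1/T = ∫ e^{-αT} dα over α > 0 turns μ(1 - e^{-⟨χ, l̂⟩}) into the integral over α of a
difference of resolvent traces, which equals log (det A_χ / det A_0)
(`MassGap.expNeg_lintegral_loopMeasure`). The Laplace functional of a Poisson process
(`IsPoissonProcess.lintegral_expNeg`) then gives the transform det A_0 / det A_χ for the occupation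
field of the loop ensemble.

Gaussian field. The weight exp(-½ ∑ χ_u |φ^u|²) replaces A_0 by A_χ in the Gaussian density. Its
mean is det A_0 / det A_χ, to the first power because real and imaginary parts each give a square
root, and inserting ½ φ^x φ̄^y multiplies this by (A_χ⁻¹)^{x,y} (`MassGap.gaussian_laplace`). These
are exactly the transforms of the loop field and of the loop field plus an independent bridge field.

Laplace transforms determine finite measures on [0, ∞]^X (`ext_of_lintegral_expNeg`), which gives
a). In b) the density ½ φ^x φ̄^y is not positive: its real and imaginary parts are treated
separately, and each identity of signed measures is stated as an equality of positive ones
(`posImage_eq_add`) before being integrated against F (`integral_smul_comp_eq_integral`). Working on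
[0, ∞], with exp(-∞) = 0, avoids proving in advance that the loop field is finite. -/

noncomputable section

/-! ### The function `a ↦ exp (-a)` on extended non-negative reals -/

/-- The function `a ↦ exp (-a)` on `[0, ∞]`. -/
def expNeg (a : ℝ≥0∞) : ℝ≥0∞ := EReal.exp (-(a : EReal))

@[simp] theorem expNeg_zero : expNeg 0 = 1 := by simp [expNeg]

@[simp] theorem expNeg_top : expNeg ∞ = 0 := by simp [expNeg]

theorem expNeg_add (a b : ℝ≥0∞) : expNeg (a + b) = expNeg a * expNeg b := by
  have ha := EReal.coe_ennreal_ne_bot a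
  have hb := EReal.coe_ennreal_ne_bot b
  rw [expNeg, EReal.coe_ennreal_add, EReal.neg_add (Or.inl ha) (Or.inr hb), sub_eq_add_neg,
    EReal.exp_add, expNeg, expNeg]

theorem expNeg_sum {ι : Type*} (s : Finset ι) (f : ι → ℝ≥0∞) :
    expNeg (∑ i ∈ s, f i) = ∏ i ∈ s, expNeg (f i) := by
  classical
  induction s using Finset.induction_on with
  | empty => simp
  | insert i s hi ih => rw [Finset.sum_insert hi, Finset.prod_insert hi, expNeg_add, ih]

theorem expNeg_ofReal {r : ℝ} (hr : 0 ≤ r) :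
    expNeg (ENNReal.ofReal r) = ENNReal.ofReal (Real.exp (-r)) := by
  rw [expNeg, EReal.coe_ennreal_ofReal, max_eq_left hr, ← EReal.coe_neg, EReal.exp_coe]

theorem expNeg_injective : Function.Injective expNeg := fun a b h => by
  have := EReal.exp_strictMono.injective h
  rwa [neg_inj, EReal.coe_ennreal_eq_coe_ennreal_iff] at this

theorem expNeg_antitone : Antitone expNeg := fun _ _ h =>
  EReal.exp_monotone (EReal.neg_le_neg_iff.2 (EReal.coe_ennreal_le_coe_ennreal_iff.2 h))

theorem expNeg_le_one (a : ℝ≥0∞) : expNeg a ≤ 1 := by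
  simpa using expNeg_antitone (bot_le : 0 ≤ a)

theorem expNeg_ne_top (a : ℝ≥0∞) : expNeg a ≠ ∞ := ne_top_of_le_ne_top (by simp) (expNeg_le_one a)

@[fun_prop]
theorem continuous_expNeg : Continuous expNeg :=
  ENNReal.continuous_exp.comp (continuous_neg.comp continuous_coe_ennreal_ereal)

@[fun_prop]
theorem measurable_expNeg : Measurable expNeg := continuous_expNeg.measurable

theorem continuous_expNeg_toReal : Continuous fun a => (expNeg a).toReal :=
  ENNReal.continuousOn_toReal.comp_continuous continuous_expNeg expNeg_ne_top

/-! ### The Laplace transform determines a finite measure on `[0, ∞]^X` -/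

section Laplace

variable {X : Type*} [Fintype X]

@[fun_prop]
theorem continuous_linearForm (χ : X → ℝ≥0) :
    Continuous fun a : X → ℝ≥0∞ => ∑ x, (χ x : ℝ≥0∞) * a x :=
  continuous_finsetSum _ fun x _ =>
    (ENNReal.continuous_const_mul ENNReal.coe_ne_top).comp (continuous_apply x)

/-- The function `a ↦ exp (-∑ χ_x a_x)` on `[0, ∞]^X`. -/
def laplaceFun (χ : X → ℝ≥0) : BoundedContinuousFunction (X → ℝ≥0∞) ℝ :=
  BoundedContinuousFunction.ofNormedAddCommGroup
    (fun a => (expNeg (∑ x, (χ x : ℝ≥0∞) * a x)).toReal)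
    (continuous_expNeg_toReal.comp (continuous_linearForm χ)) 1 fun a => by
      rw [Real.norm_of_nonneg ENNReal.toReal_nonneg]
      exact ENNReal.toReal_le_of_le_ofReal zero_le_one (by simpa using expNeg_le_one _)

theorem laplaceFun_apply (χ : X → ℝ≥0) (a : X → ℝ≥0∞) :
    laplaceFun χ a = (expNeg (∑ x, (χ x : ℝ≥0∞) * a x)).toReal := rfl

/-- The functions `laplaceFun χ` form a monoid under multiplication. -/
def laplaceHom : Multiplicative (X → ℝ≥0) →* BoundedContinuousFunction (X → ℝ≥0∞) ℝ where
  toFun χ := laplaceFun χ.toAdd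
  map_one' := by ext a; simp [laplaceFun_apply]
  map_mul' χ χ' := by
    ext a
    simp [laplaceFun_apply, add_mul, Finset.sum_add_distrib, expNeg_add]

/-- The exponentials are closed under products, so their linear span is already an algebra. It
separates points, and a separating star subalgebra of bounded continuous functions determines finite
measures on a Polish space. -/
theorem ext_of_lintegral_expNeg {μ ν : Measure (X → ℝ≥0∞)} [IsFiniteMeasure μ] [IsFiniteMeasure ν]
    (h : ∀ χ : X → ℝ≥0, ∫⁻ a, expNeg (∑ x, (χ x : ℝ≥0∞) * a x) ∂μ =
      ∫⁻ a, expNeg (∑ x, (χ x : ℝ≥0∞) * a x) ∂ν) : μ = ν := by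
  classical
  let A : StarSubalgebra ℝ (BoundedContinuousFunction (X → ℝ≥0∞) ℝ) :=
    { Algebra.adjoin ℝ (MonoidHom.mrange (laplaceHom (X := X)) : Set _) with
      star_mem' := fun {g} hg => by
        have : star g = g := by ext a; simp
        rwa [this] }
  have hmem (χ : X → ℝ≥0) : laplaceFun χ ∈ A :=
    Algebra.subset_adjoin ⟨Multiplicative.ofAdd χ, rfl⟩
  refine ext_of_forall_mem_subalgebra_integral_eq_of_polish (𝕜 := ℝ) (A := A) ?_ ?_
  · intro a b hab
    obtain ⟨x, hx⟩ := Function.ne_iff.1 hab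
    -- The unit vector at a coordinate where a and b differ isolates that coordinate, and `expNeg`
    -- is injective up to and including ∞.
    refine ⟨laplaceFun (Pi.single x 1), ⟨_, ⟨_, hmem _, rfl⟩, rfl⟩, ?_⟩
    have key (a : X → ℝ≥0∞) : ∑ y, ((Pi.single x 1 : X → ℝ≥0) y : ℝ≥0∞) * a y = a x := by
      rw [Finset.sum_eq_single x] <;> simp +contextual
    rw [laplaceFun_apply, laplaceFun_apply, key, key]
    intro h
    exact hx (expNeg_injective
      ((ENNReal.toReal_eq_toReal_iff' (expNeg_ne_top _) (expNeg_ne_top _)).1 h))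
  · intro g hg
    -- The generators form a submonoid, so membership in the algebra reduces to linear combinations
    -- and the induction needs no product case.
    have hg' : g ∈ Submodule.span ℝ (MonoidHom.mrange (laplaceHom (X := X)) : Set _) := by
      have h0 : g ∈ Subalgebra.toSubmodule
          (Algebra.adjoin ℝ (MonoidHom.mrange (laplaceHom (X := X)) : Set _)) := hg
      rwa [Algebra.adjoin_eq_span, Submonoid.closure_eq] at h0
    clear hg
    induction hg' using Submodule.span_induction with
    | mem g hg =>
      obtain ⟨χ, rfl⟩ := hg
      change ∫ a, (expNeg _).toReal ∂μ = ∫ a, (expNeg _).toReal ∂ν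
      rw [integral_toReal, integral_toReal, h χ.toAdd]
      all_goals first
        | exact Filter.Eventually.of_forall fun a => (expNeg_ne_top _).lt_top
        | exact (measurable_expNeg.comp (continuous_linearForm _).measurable).aemeasurable
    | zero => simp
    | add g g' _ _ ih ih' =>
      simp only [BoundedContinuousFunction.coe_add, Pi.add_apply]
      rw [integral_add (g.integrable _) (g'.integrable _), ih, ih',
        integral_add (g.integrable _) (g'.integrable _)]
    | smul c g _ ih =>
      simp only [BoundedContinuousFunction.coe_smul]
      rw [integral_smul, integral_smul, ih]

end Laplace

/-! ### The Laplace functional of a Poisson process -/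

theorem lintegral_expNeg_poissonMeasure (r c : ℝ≥0) :
    ∫⁻ n : ℕ, expNeg (c * n) ∂(poissonMeasure r) = expNeg ((1 - expNeg c) * r) := by
  have hc : expNeg (c : ℝ≥0∞) = ENNReal.ofReal (Real.exp (-c)) := by
    rw [← ENNReal.ofReal_coe_nnreal, expNeg_ofReal c.coe_nonneg]
  have hle : Real.exp (-(c : ℝ)) ≤ 1 := Real.exp_le_one_iff.2 (by simp)
  have hsum : HasSum (fun n : ℕ => Real.exp (-r) * r ^ n / n.factorial * Real.exp (-c) ^ n)
      (Real.exp (-((1 - Real.exp (-c)) * r))) := by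
    have h := (NormedSpace.expSeries_div_hasSum_exp (r * Real.exp (-(c : ℝ)))).mul_left
      (Real.exp (-r))
    rw [← Real.exp_eq_exp_ℝ, ← Real.exp_add] at h
    have e1 : -((1 - Real.exp (-(c : ℝ))) * r) = -r + r * Real.exp (-(c : ℝ)) := by ring
    rw [e1]
    refine h.congr_fun fun n => ?_
    rw [mul_pow]
    ring
  rw [hc, ← ENNReal.ofReal_one, ← ENNReal.ofReal_sub _ (Real.exp_pos _).le,
    ← ENNReal.ofReal_coe_nnreal (p := r), ← ENNReal.ofReal_mul (sub_nonneg.2 hle),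
    expNeg_ofReal (mul_nonneg (sub_nonneg.2 hle) r.coe_nonneg), ← hsum.tsum_eq,
    ENNReal.ofReal_tsum_of_nonneg (fun n => by positivity) hsum.summable,
    poissonMeasure, lintegral_sum_measure]
  refine tsum_congr fun n => ?_
  rw [lintegral_smul_measure, lintegral_dirac, smul_eq_mul, ENNReal.ofReal_mul (by positivity),
    ← Real.exp_nat_mul, ← ENNReal.ofReal_coe_nnreal, ← ENNReal.ofReal_natCast,
    ← ENNReal.ofReal_mul c.coe_nonneg, expNeg_ofReal (mul_nonneg c.coe_nonneg n.cast_nonneg)]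
  congr 3
  ring

namespace IsPoissonProcess

variable {Ω E : Type*} [MeasurableSpace Ω] [MeasurableSpace E] {N : Ω → Measure E}
  {ν : Measure E} {Pr : Measure Ω} [IsProbabilityMeasure Pr]

/-- For finite ν A this is the Poisson generating function. If ν A = ∞ and c > 0, then N A = ∞
almost surely and 1 - e^{-c} > 0, so both sides vanish. -/
theorem lintegral_expNeg_mul_apply (h : IsPoissonProcess N ν Pr) {A : Set E}
    (hA : MeasurableSet A) {c : ℝ≥0∞} (hc : c ≠ ∞) :
    ∫⁻ ω, expNeg (c * N ω A) ∂Pr = expNeg ((1 - expNeg c) * ν A) := by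
  rcases eq_or_ne c 0 with rfl | hc0
  · simp
  by_cases hν : ν A = ∞
  · have h1 : 1 - expNeg c ≠ 0 := by
      rw [Ne, tsub_eq_zero_iff_le, ← expNeg_zero]
      intro hle
      exact hc0 (expNeg_injective (le_antisymm (expNeg_antitone bot_le) hle))
    rw [hν, ENNReal.mul_top h1, expNeg_top, lintegral_eq_zero_iff' (by
      have := (Measure.measurable_coe hA).comp h.measurable
      fun_prop)]
    filter_upwards [h.infinite A hA hν] with ω hω
    simp [hω, ENNReal.mul_top hc0]
  · lift c to ℝ≥0 using hc
    have hN : Measurable fun ω => N ω A := (Measure.measurable_coe hA).comp h.measurable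
    have hg : Measurable fun a : ℝ≥0∞ => expNeg (c * a) := by fun_prop
    rw [← lintegral_map hg hN, h.poisson A hA hν, lintegral_map hg .of_discrete,
      lintegral_expNeg_poissonMeasure, ENNReal.coe_toNNReal hν]

/-- The level sets of f are disjoint, so their point counts are independent and the expectation
factorizes over the values of f. -/
theorem lintegral_expNeg_simpleFunc (h : IsPoissonProcess N ν Pr) (f : SimpleFunc E ℝ≥0∞)
    (hf : ∀ e, f e ≠ ∞) :
    ∫⁻ ω, expNeg (∫⁻ e, f e ∂(N ω)) ∂Pr = expNeg (∫⁻ e, 1 - expNeg (f e) ∂ν) := by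
  have hN (A : Set E) (hA : MeasurableSet A) : Measurable fun ω => N ω A :=
    (Measure.measurable_coe hA).comp h.measurable
  have hν : ∫⁻ e, 1 - expNeg (f e) ∂ν = ∑ c ∈ f.range, (1 - expNeg c) * ν (f ⁻¹' {c}) := by
    rw [← SimpleFunc.map_lintegral, ← SimpleFunc.lintegral_eq_lintegral]
    rfl
  let c : Fin f.range.card → ℝ≥0∞ := fun i => (f.range.equivFin.symm i).1
  have hsum (g : ℝ≥0∞ → ℝ≥0∞) : ∑ a ∈ f.range, g a = ∑ i, g (c i) := by
    rw [← Finset.sum_coe_sort]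
    exact (Equiv.sum_comp f.range.equivFin.symm fun a => g a.1).symm
  have hind : iIndepFun (fun i ω => expNeg (c i * N ω (f ⁻¹' {c i}))) Pr := by
    refine (h.indep _ (fun i => f ⁻¹' {c i}) (fun i => f.measurableSet_fiber _) ?_).comp
      (fun i a => expNeg (c i * a)) fun i => by fun_prop
    intro i j hij
    refine Disjoint.preimage _ (Set.disjoint_singleton.2 fun heq => hij ?_)
    exact f.range.equivFin.symm.injective (Subtype.ext heq)
  rw [hν, hsum, expNeg_sum]
  simp_rw [SimpleFunc.lintegral_eq_lintegral, SimpleFunc.lintegral]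
  simp_rw [hsum, expNeg_sum]
  rw [lintegral_prod_eq_prod_lintegral_of_indepFun _ _ hind fun i => by
    have := hN _ (f.measurableSet_fiber (c i))
    fun_prop]
  refine Finset.prod_congr rfl fun i _ => ?_
  refine h.lintegral_expNeg_mul_apply (f.measurableSet_fiber _) ?_
  obtain ⟨e, he⟩ := SimpleFunc.mem_range.1 (f.range.equivFin.symm i).2
  change (f.range.equivFin.symm i).1 ≠ ∞
  rw [← he]
  exact hf e

/-- The Laplace functional of a Poisson process. -/
theorem lintegral_expNeg (h : IsPoissonProcess N ν Pr) {f : E → ℝ≥0∞} (hf : Measurable f) :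
    ∫⁻ ω, expNeg (∫⁻ e, f e ∂(N ω)) ∂Pr = expNeg (∫⁻ e, 1 - expNeg (f e) ∂ν) := by
  have hmono (e : E) : Monotone fun n => SimpleFunc.eapprox f n e :=
    fun _ _ hnm => SimpleFunc.monotone_eapprox f hnm e
  have hlim (e : E) : Filter.Tendsto (fun n => SimpleFunc.eapprox f n e) Filter.atTop
      (nhds (f e)) := by
    rw [← SimpleFunc.iSup_eapprox_apply hf e]
    exact tendsto_atTop_iSup (hmono e)
  have hmeas (n : ℕ) : Measurable (SimpleFunc.eapprox f n) := (SimpleFunc.eapprox f n).measurable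
  -- On this side the inner integrals increase, but `expNeg` reverses order; the outer limit is
  -- therefore taken by domination by 1. On the other side 1 - e^{-f} is increasing in f and
  -- monotone convergence suffices.
  have hl : Filter.Tendsto (fun n => ∫⁻ ω, expNeg (∫⁻ e, SimpleFunc.eapprox f n e ∂(N ω)) ∂Pr)
      Filter.atTop (nhds (∫⁻ ω, expNeg (∫⁻ e, f e ∂(N ω)) ∂Pr)) := by
    refine tendsto_lintegral_of_dominated_convergence (fun _ => 1) (fun n => ?_)
      (fun n => Filter.Eventually.of_forall fun ω => expNeg_le_one _) (by simp)
      (Filter.Eventually.of_forall fun ω => ?_)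
    · exact measurable_expNeg.comp ((Measure.measurable_lintegral (hmeas n)).comp h.measurable)
    · exact (continuous_expNeg.tendsto _).comp (lintegral_tendsto_of_tendsto_of_monotone
        (fun n => (hmeas n).aemeasurable) (Filter.Eventually.of_forall hmono)
        (Filter.Eventually.of_forall hlim))
  have hr : Filter.Tendsto (fun n => expNeg (∫⁻ e, 1 - expNeg (SimpleFunc.eapprox f n e) ∂ν))
      Filter.atTop (nhds (expNeg (∫⁻ e, 1 - expNeg (f e) ∂ν))) := by
    refine (continuous_expNeg.tendsto _).comp (lintegral_tendsto_of_tendsto_of_monotone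
      (fun n => ?_) (Filter.Eventually.of_forall fun e => ?_)
      (Filter.Eventually.of_forall fun e => ?_))
    · have := hmeas n
      exact (measurable_const.sub (measurable_expNeg.comp this)).aemeasurable
    · exact fun n m hnm => tsub_le_tsub_left (expNeg_antitone (hmono e hnm)) 1
    · exact ENNReal.Tendsto.sub tendsto_const_nhds ((continuous_expNeg.tendsto _).comp (hlim e))
        (Or.inl ENNReal.one_ne_top)
  refine tendsto_nhds_unique hl (hr.congr fun n => ?_)
  exact (h.lintegral_expNeg_simpleFunc _ fun e => (SimpleFunc.eapprox_lt_top f n e).ne).symm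

end IsPoissonProcess

/-! ### Occupation times of a path in terms of its holding times -/

namespace ChainPath

variable {X : Type*}

/-- The time at which the `k`-th state is reached: the sum of the first `k` holding times. -/
def arrivalTime (γ : ChainPath X) (k : ℕ) : ℝ :=
  ∑ i : Fin (γ.1.1 + 1), if (i : ℕ) < k then (γ.2 i : ℝ) else 0

theorem arrivalTime_mono (γ : ChainPath X) : Monotone γ.arrivalTime := fun k l hkl => by
  refine Finset.sum_le_sum fun i _ => ?_
  have := (Set.mem_Ioi.1 (γ.2 i).2).le
  split_ifs <;> first | omega | simp_all

theorem arrivalTime_zero (γ : ChainPath X) : γ.arrivalTime 0 = 0 := by simp [arrivalTime]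

theorem sum_ite_lt_succ {A : Type*} [AddCommMonoid A] {n : ℕ} (f : Fin n → A) (k : Fin n) :
    (∑ i : Fin n, if (i : ℕ) < k + 1 then f i else 0)
      = (∑ i : Fin n, if (i : ℕ) < k then f i else 0) + f k := by
  have h (i : Fin n) : (if (i : ℕ) < k + 1 then f i else 0)
      = (if (i : ℕ) < k then f i else 0) + if i = k then f i else 0 := by
    rcases lt_trichotomy (i : ℕ) k with h | h | h
    · have : i ≠ k := fun e => by simp [e] at h
      simp [h, h.trans (Nat.lt_succ_self _), this]
    · have : i = k := Fin.ext h
      simp [this]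
    · have : i ≠ k := fun e => by simp [e] at h
      simp [this, h.not_gt, show ¬ (i : ℕ) < k + 1 by omega]
  rw [Finset.sum_congr rfl fun i _ => h i, Finset.sum_add_distrib]
  simp

theorem arrivalTime_succ (γ : ChainPath X) (k : Fin (γ.1.1 + 1)) :
    γ.arrivalTime (k + 1) = γ.arrivalTime k + γ.2 k :=
  sum_ite_lt_succ (fun i => (γ.2 i : ℝ)) k

theorem arrivalTime_eq_duration (γ : ChainPath X) : γ.arrivalTime (γ.1.1 + 1) = γ.duration :=
  Finset.sum_congr rfl fun i _ => if_pos i.2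

/-- Jump j ends the holding time of state j and is the arrival at state j + 1: this is the index
shift between the two conventions. -/
theorem jumpTime_eq (γ : ChainPath X) (j : Fin γ.1.1) : γ.jumpTime j = γ.arrivalTime (j + 1) := by
  simp only [jumpTime, arrivalTime, Nat.lt_succ_iff]

theorem stateAt_eq (γ : ChainPath X) (k : Fin (γ.1.1 + 1)) {t : ℝ}
    (ht : t ∈ Set.Ico (γ.arrivalTime k) (γ.arrivalTime (k + 1))) : γ.stateAt t = γ.1.2 k := by
  classical
  have h : γ.jumpsUpTo t = k := by
    have hset : (Finset.univ.filter fun j : Fin γ.1.1 => γ.jumpTime j ≤ t)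
        = Finset.univ.filter fun j : Fin γ.1.1 => (j : ℕ) < k := by
      refine Finset.filter_congr fun j _ => ?_
      rw [jumpTime_eq]
      constructor
      · intro h
        by_contra hlt
        exact absurd (ht.2.trans_le ((γ.arrivalTime_mono (by omega)).trans h)) (lt_irrefl _)
      · intro h
        exact (γ.arrivalTime_mono h).trans ht.1
    have hcard : γ.jumpsUpTo t = (Finset.univ.filter fun j : Fin γ.1.1 => γ.jumpTime j ≤ t).card := by
      unfold jumpsUpTo
      congr
    rw [hcard, hset, Fin.card_filter_val_lt]
    have := k.2
    omega
  simp only [stateAt, h]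

/-- The trajectory is constant between consecutive arrival times; [0, T) is filled one such interval
at a time. -/
theorem timeSpent_stateAt (γ : ChainPath X) (x : X) :
    timeSpent γ.stateAt γ.duration x
      = ∑ i, Set.indicator {x} 1 (γ.1.2 i) * ENNReal.ofReal (γ.2 i) := by
  have key (k : ℕ) (hk : k ≤ γ.1.1 + 1) :
      ∫⁻ t in Set.Ico 0 (γ.arrivalTime k), Set.indicator {x} (1 : X → ℝ≥0∞) (γ.stateAt t)
        = ∑ i : Fin (γ.1.1 + 1), if (i : ℕ) < k then
            Set.indicator {x} 1 (γ.1.2 i) * ENNReal.ofReal (γ.2 i) else 0 := by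
    induction k with
    | zero => simp [arrivalTime_zero]
    | succ k ih =>
      have h0 : 0 ≤ γ.arrivalTime k := by
        rw [← γ.arrivalTime_zero]
        exact γ.arrivalTime_mono (Nat.zero_le k)
      have h1 : γ.arrivalTime k ≤ γ.arrivalTime (k + 1) := γ.arrivalTime_mono (Nat.le_succ k)
      have hstep := γ.arrivalTime_succ ⟨k, hk⟩
      have hint : ∫⁻ t in Set.Ico (γ.arrivalTime k) (γ.arrivalTime (k + 1)),
          Set.indicator {x} (1 : X → ℝ≥0∞) (γ.stateAt t)
            = Set.indicator {x} 1 (γ.1.2 ⟨k, hk⟩) * ENNReal.ofReal (γ.2 ⟨k, hk⟩) := by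
        rw [setLIntegral_congr_fun measurableSet_Ico
          (g := fun _ => Set.indicator {x} (1 : X → ℝ≥0∞) (γ.1.2 ⟨k, hk⟩))
          fun t ht => by simp only [γ.stateAt_eq ⟨k, hk⟩ ht]]
        rw [setLIntegral_const, Real.volume_Ico]
        congr 2
        simp only at hstep
        linarith
      rw [← Set.Ico_union_Ico_eq_Ico h0 h1,
        lintegral_union measurableSet_Ico (Set.Ico_disjoint_Ico_same), ih (by omega), hint]
      exact (sum_ite_lt_succ (fun i : Fin (γ.1.1 + 1) =>
        Set.indicator {x} (1 : X → ℝ≥0∞) (γ.1.2 i) * ENNReal.ofReal (γ.2 i)) ⟨k, hk⟩).symm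
  rw [timeSpent, ← arrivalTime_eq_duration, key _ le_rfl]
  exact Finset.sum_congr rfl fun i _ => if_pos i.2

theorem measurableSet_iff {X : Type*} {s : Set (ChainPath X)} :
    MeasurableSet s ↔ ∀ w, MeasurableSet (Sigma.mk w ⁻¹' s) :=
  MeasurableSpace.measurableSet_iInf

theorem measurable_of_sigma {β : Type*} [MeasurableSpace β] {f : ChainPath X → β}
    (h : ∀ w, Measurable fun s => f ⟨w, s⟩) : Measurable f := fun _ hs =>
  measurableSet_iff.2 fun w => h w hs

theorem measurable_mk (w : DiscretePath X) :
    Measurable fun s : Fin (w.1 + 1) → Set.Ioi (0 : ℝ) => (⟨w, s⟩ : ChainPath X) := fun _ hs =>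
  measurableSet_iff.1 hs w

theorem measurable_timeSpent (x : X) :
    Measurable fun γ : ChainPath X => timeSpent γ.stateAt γ.duration x :=
  measurable_of_sigma fun w => by
    simp only [timeSpent_stateAt]
    change Measurable fun s : Fin (w.1 + 1) → Set.Ioi (0 : ℝ) =>
      ∑ i, Set.indicator {x} (1 : X → ℝ≥0∞) (w.2 i) * ENNReal.ofReal (s i)
    refine Finset.measurable_fun_sum _ fun i _ => ?_
    fun_prop

theorem measurable_duration : Measurable (duration : ChainPath X → ℝ) :=
  measurable_of_sigma fun w => by
    simp only [duration]
    change Measurable fun s : Fin (w.1 + 1) → Set.Ioi (0 : ℝ) => ∑ i, (s i : ℝ)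
    refine Finset.measurable_fun_sum _ fun i _ => ?_
    fun_prop

end ChainPath

/-- Fubini's theorem for the product of functions of the coordinates. -/
theorem lintegral_fin_prod_eq_prod {n : ℕ} {E : Fin n → Type*} {mE : ∀ i, MeasurableSpace (E i)}
    {μ : (i : Fin n) → Measure (E i)} [∀ i, SigmaFinite (μ i)] {f : (i : Fin n) → E i → ℝ≥0∞}
    (hf : ∀ i, Measurable (f i)) :
    ∫⁻ x, ∏ i, f i (x i) ∂(Measure.pi μ) = ∏ i, ∫⁻ x, f i x ∂(μ i) := by
  induction n with
  | zero => simp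
  | succ n ih =>
    have h := (measurePreserving_piFinSuccAbove μ 0).symm
    rw [← h.lintegral_comp_emb (MeasurableEquiv.measurableEmbedding _)]
    simp_rw [MeasurableEquiv.piFinSuccAbove_symm_apply, Fin.insertNthEquiv,
      Fin.prod_univ_succ, Fin.insertNth_zero]
    have hg : Measurable fun y : (j : Fin n) → E j.succ => ∏ j, f j.succ (y j) :=
      Finset.measurable_fun_prod _ fun j _ => (hf j.succ).comp (measurable_pi_apply j)
    rw [← ih (f := fun j => f j.succ) (μ := fun j => μ j.succ) fun j => hf j.succ,
      ← lintegral_prod_mul (hf 0).aemeasurable hg.aemeasurable]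
    rfl

theorem lintegral_exp_neg_mul {c : ℝ} (hc : 0 < c) :
    ∫⁻ s in Set.Ioi (0 : ℝ), ENNReal.ofReal (Real.exp (-(c * s))) = ENNReal.ofReal c⁻¹ := by
  have hi : IntegrableOn (fun s : ℝ => Real.exp (-c * s)) (Set.Ioi 0) :=
    integrableOn_exp_mul_Ioi (neg_lt_zero.2 hc) 0
  have h := integral_exp_mul_Ioi (neg_lt_zero.2 hc) 0
  simp_rw [← neg_mul]
  rw [← ofReal_integral_eq_lintegral_ofReal hi (Filter.Eventually.of_forall fun s =>
    (Real.exp_pos _).le), h]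
  simp

/-! ### Laplace transform of the holding times along a fixed discrete path -/

namespace SymmetricChain

variable {X : Type*} [Fintype X] (M : SymmetricChain X)

theorem m_pos (x : X) : 0 < M.m x := div_pos (M.lam_pos x) (M.q_pos x)

theorem measurable_pathOccupation (x : X) : Measurable fun γ => M.pathOccupation γ x :=
  (ChainPath.measurable_timeSpent x).div_const _

/-- Regrouping the sum over states as a sum over visits makes the exponent linear in the holding
times; the division by m is the normalization of the occupation field. -/
theorem expNeg_sum_mul_pathOccupation {θ : X → ℝ} (hθ : ∀ x, 0 ≤ θ x) (γ : ChainPath X) :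
    expNeg (∑ x, ENNReal.ofReal (θ x) * M.pathOccupation γ x)
      = ∏ i, ENNReal.ofReal (Real.exp (-(θ (γ.1.2 i) / M.m (γ.1.2 i) * γ.2 i))) := by
  classical
  have h : ∑ x, ENNReal.ofReal (θ x) * M.pathOccupation γ x
      = ∑ i, ENNReal.ofReal (θ (γ.1.2 i) / M.m (γ.1.2 i) * γ.2 i) := by
    simp only [pathOccupation, ChainPath.timeSpent_stateAt, div_eq_mul_inv, Finset.sum_mul,
      Finset.mul_sum]
    rw [Finset.sum_comm]
    refine Finset.sum_congr rfl fun i _ => ?_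
    rw [Finset.sum_eq_single (γ.1.2 i)]
    · have hm := M.m_pos (γ.1.2 i)
      rw [ENNReal.ofReal_mul (mul_nonneg (hθ _) (inv_pos.2 hm).le), ENNReal.ofReal_mul (hθ _),
        ENNReal.ofReal_inv_of_pos hm]
      simp
      ring
    · intro x _ hx
      simp [Set.indicator, hx.symm]
    · simp
  rw [h, expNeg_sum]
  exact Finset.prod_congr rfl fun i _ =>
    expNeg_ofReal (mul_nonneg (div_nonneg (hθ _) (M.m_pos _).le) (Set.mem_Ioi.1 (γ.2 i).2).le)

instance isFiniteMeasure_expDensity (x : X) :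
    IsFiniteMeasure (((volume : Measure ℝ).comap
      (Subtype.val : Set.Ioi (0 : ℝ) → ℝ)).withDensity
        fun s => ENNReal.ofReal (Real.exp (-(M.q x * (s : ℝ))))) := by
  refine isFiniteMeasure_withDensity ?_
  rw [lintegral_subtype_comap measurableSet_Ioi
    (fun s => ENNReal.ofReal (Real.exp (-(M.q x * s)))), lintegral_exp_neg_mul (M.q_pos x)]
  exact ENNReal.ofReal_ne_top

theorem lintegral_holdingMeasure {θ : X → ℝ} (hθ : ∀ x, 0 ≤ θ x) (w : DiscretePath X) :
    ∫⁻ s, expNeg (∑ x, ENNReal.ofReal (θ x) * M.pathOccupation ⟨w, s⟩ x) ∂(M.holdingMeasure w)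
      = ENNReal.ofReal (M.jumpWeight w) *
        ∏ i, ENNReal.ofReal (M.q (w.2 i) + θ (w.2 i) / M.m (w.2 i))⁻¹ := by
  simp only [M.expNeg_sum_mul_pathOccupation hθ]
  rw [holdingMeasure, lintegral_smul_measure, smul_eq_mul]
  congr 1
  rw [lintegral_fin_prod_eq_prod (f := fun i (s : Set.Ioi (0 : ℝ)) =>
    ENNReal.ofReal (Real.exp (-(θ (w.2 i) / M.m (w.2 i) * s)))) fun i => by fun_prop]
  refine Finset.prod_congr rfl fun i _ => ?_
  rw [lintegral_withDensity_eq_lintegral_mul _ (by fun_prop) (by fun_prop)]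
  have hc : 0 < M.q (w.2 i) + θ (w.2 i) / M.m (w.2 i) :=
    add_pos_of_pos_of_nonneg (M.q_pos _) (div_nonneg (hθ _) (M.m_pos _).le)
  rw [← lintegral_exp_neg_mul hc, ← lintegral_subtype_comap measurableSet_Ioi
    (fun s => ENNReal.ofReal (Real.exp (-((M.q (w.2 i) + θ (w.2 i) / M.m (w.2 i)) * s))))]
  refine lintegral_congr fun s => ?_
  rw [Pi.mul_apply, ← ENNReal.ofReal_mul (Real.exp_pos _).le, ← Real.exp_add]
  congr 2
  ring

end SymmetricChain

/-! ### Sums over discrete paths -/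

section PathSum

variable {X : Type*} [Fintype X] [DecidableEq X] (Q : X → X → ℝ≥0∞) (c : X → ℝ≥0∞)

/-- The sum over the discrete paths with `n` jumps from `x` to `y` of the product of the weights
`Q` of the jumps and of the weights `c` of the states. -/
def pathSum (n : ℕ) (x y : X) : ℝ≥0∞ :=
  ∑ w : Fin (n + 1) → X, if w 0 = x ∧ w (Fin.last n) = y then
    (∏ i : Fin n, Q (w i.castSucc) (w i.succ)) * ∏ i, c (w i) else 0

theorem pathSum_zero (x y : X) : pathSum Q c 0 x y = if x = y then c x else 0 := by
  rw [pathSum, ← (Equiv.funUnique (Fin 1) X).symm.sum_comp]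
  simp only [Equiv.funUnique_symm_apply, uniqueElim_const]
  rw [Finset.sum_eq_single x]
  · simp
  · intro z _ hz; simp [hz]
  · simp

/-- Decomposition at the first jump: the initial state is split off and the remaining path starts at
z. -/
theorem pathSum_succ (n : ℕ) (x y : X) :
    pathSum Q c (n + 1) x y = c x * ∑ z, Q x z * pathSum Q c n z y := by
  simp only [pathSum]
  rw [← (Fin.consEquiv fun _ => X).sum_comp, Fintype.sum_prod_type, Finset.sum_eq_single x]
  · simp only [Finset.mul_sum]
    rw [Finset.sum_comm]
    refine Finset.sum_congr rfl fun w _ => ?_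
    rw [Finset.sum_eq_single (w 0)]
    · simp only [Fin.consEquiv, Equiv.coe_fn_mk, Fin.cons_zero, true_and, ← Fin.succ_last,
        Fin.cons_succ, Fin.prod_univ_succ, Fin.castSucc_zero, Fin.castSucc_succ]
      split_ifs
      · ring
      · simp
    · intro z _ hz
      simp [hz.symm]
    · simp
  · intro z _ hz
    simp [Fin.consEquiv, hz]
  · simp

/-- The sum over all discrete paths from `x` to `y`. -/
def pathGreen (x y : X) : ℝ≥0∞ := ∑' n, pathSum Q c n x y

theorem pathGreen_eq (x y : X) :
    pathGreen Q c x y = (if x = y then c x else 0) + c x * ∑ z, Q x z * pathGreen Q c z y := by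
  rw [pathGreen, tsum_eq_zero_add' ENNReal.summable, pathSum_zero]
  simp only [pathSum_succ, pathGreen, ENNReal.tsum_mul_left]
  rw [Summable.tsum_finsetSum fun _ _ => ENNReal.summable]
  simp only [ENNReal.tsum_mul_left]

/-- A supersolution of the first-step equation dominates every partial sum by induction. This is how
finiteness of the path sum is obtained without any estimate of a spectral radius. -/
theorem pathGreen_le {v : X → ℝ≥0∞} (hv : ∀ x, c x * (1 + ∑ z, Q x z * v z) ≤ v x) (x y : X) :
    pathGreen Q c x y ≤ v x := by
  have key (N : ℕ) : ∀ x, ∑ n ∈ Finset.range N, pathSum Q c n x y ≤ v x := by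
    induction N with
    | zero => simp
    | succ N ih =>
      intro x
      refine le_trans ?_ (hv x)
      rw [Finset.sum_range_succ', add_comm, mul_add, mul_one, pathSum_zero]
      refine add_le_add (by split_ifs <;> simp) ?_
      simp only [pathSum_succ]
      rw [← Finset.mul_sum, Finset.sum_comm]
      gcongr with z
      rw [← Finset.mul_sum]
      gcongr
      exact ih z
  rw [pathGreen, ENNReal.tsum_eq_iSup_nat]
  exact iSup_le fun N => key N x

theorem tsum_discretePath (x y : X) :
    ∑' w : {w : DiscretePath X // w.first = x ∧ w.last = y},
      (∏ i : Fin w.1.1, Q (w.1.2 i.castSucc) (w.1.2 i.succ)) * ∏ i, c (w.1.2 i)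
      = pathGreen Q c x y := by
  refine (tsum_subtype {w : DiscretePath X | w.first = x ∧ w.last = y} fun w : DiscretePath X =>
    (∏ i : Fin w.1, Q (w.2 i.castSucc) (w.2 i.succ)) * ∏ i, c (w.2 i)).trans ?_
  rw [ENNReal.tsum_sigma']
  refine tsum_congr fun n => ?_
  rw [tsum_fintype, pathSum]
  refine Finset.sum_congr rfl fun w _ => ?_
  simp only [Set.indicator_apply, Set.mem_ofPred_eq, DiscretePath.first, DiscretePath.last]

end PathSum

/-! ### The killed Laplacian, its maximum principle, and the transform of the bridge measure -/

namespace SymmetricChain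

variable {X : Type*} [Fintype X] (M : SymmetricChain X)

theorem conductance_nonneg (x y : X) : 0 ≤ M.conductance x y :=
  mul_nonneg (M.lam_pos x).le (M.P_nonneg x y)

theorem conductance_symm (x y : X) : M.conductance x y = M.conductance y x := M.P_symm x y

/-- Expanding the squares produces the row sums ∑_y C_{x,y} = λ_x - κ_x, and the killing term
restores λ_x: the energy is the quadratic form of M_λ - C. -/
theorem energy_ofReal (z : X → ℝ) :
    M.energy (fun x => (z x : ℂ))
      = ∑ x, M.lam x * z x ^ 2 - ∑ x, ∑ y, M.conductance x y * (z x * z y) := by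
  have hC (x : X) : ∑ y, M.conductance x y = M.lam x - M.kill x := by
    simp only [conductance, kill, ← Finset.mul_sum]
    ring
  have h1 : ∑ x, ∑ y, M.conductance x y * z x ^ 2 = ∑ x, (M.lam x - M.kill x) * z x ^ 2 := by
    refine Finset.sum_congr rfl fun x _ => ?_
    rw [← Finset.sum_mul, hC]
  have h2 : ∑ x, ∑ y, M.conductance x y * z y ^ 2 = ∑ x, (M.lam x - M.kill x) * z x ^ 2 := by
    rw [← h1, Finset.sum_comm]
    refine Finset.sum_congr rfl fun x _ => Finset.sum_congr rfl fun y _ => ?_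
    rw [M.conductance_symm]
  have h3 : ∑ x, ∑ y, M.conductance x y * ‖(z x : ℂ) - z y‖ ^ 2
      = ∑ x, ∑ y, M.conductance x y * z x ^ 2 + ∑ x, ∑ y, M.conductance x y * z y ^ 2
        - 2 * ∑ x, ∑ y, M.conductance x y * (z x * z y) := by
    simp only [Finset.mul_sum, ← Finset.sum_add_distrib, ← Finset.sum_sub_distrib]
    refine Finset.sum_congr rfl fun x _ => Finset.sum_congr rfl fun y _ => ?_
    rw [← Complex.ofReal_sub, Complex.norm_real, Real.norm_eq_abs, sq_abs]
    ring
  rw [energy, h3, h1, h2]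
  simp only [Complex.norm_real, Real.norm_eq_abs, sq_abs, sub_mul, Finset.sum_sub_distrib]
  ring

variable [DecidableEq X]

/-- The matrix `M_λ + M_θ - C`. -/
def killedLaplacian (θ : X → ℝ) : Matrix X X ℝ :=
  Matrix.diagonal (M.lam + θ) - Matrix.of M.conductance

theorem killedLaplacian_mulVec (θ z : X → ℝ) (x : X) :
    (M.killedLaplacian θ).mulVec z x
      = (M.lam x + θ x) * z x - ∑ y, M.conductance x y * z y := by
  rw [killedLaplacian, Matrix.sub_mulVec, Pi.sub_apply, Matrix.mulVec_diagonal]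
  rfl

theorem green_eq : M.green = (M.killedLaplacian 0)⁻¹ := by simp [green, killedLaplacian]

theorem killedLaplacian_eq_add (θ : X → ℝ) :
    M.killedLaplacian θ = M.killedLaplacian 0 + Matrix.diagonal θ := by
  have h : Matrix.diagonal (M.lam + θ) = Matrix.diagonal M.lam + Matrix.diagonal θ :=
    (Matrix.diagonal_add _ _).symm
  rw [killedLaplacian, killedLaplacian, add_zero, h]
  abel

theorem isHermitian_killedLaplacian (θ : X → ℝ) : (M.killedLaplacian θ).IsHermitian := by
  ext x y
  simp only [killedLaplacian, Matrix.conjTranspose_apply, Matrix.sub_apply, Matrix.of_apply,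
    star_trivial, M.conductance_symm x y, Matrix.diagonal_apply, eq_comm (a := y)]
  split_ifs with h <;> simp [h]

variable {M}

theorem MassGap.posDef_killedLaplacian (hM : M.MassGap) {θ : X → ℝ} (hθ : ∀ x, 0 ≤ θ x) :
    (M.killedLaplacian θ).PosDef := by
  have h0 : (M.killedLaplacian 0).PosDef := by
    refine Matrix.PosDef.of_dotProduct_mulVec_pos (M.isHermitian_killedLaplacian 0) fun z hz => ?_
    obtain ⟨ε, hε, h⟩ := hM
    have he := h fun x => (z x : ℂ)
    rw [energy_ofReal] at he
    obtain ⟨x, hx⟩ := Function.ne_iff.1 hz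
    have hpos : 0 < ∑ x, M.m x * ‖(z x : ℂ)‖ ^ 2 :=
      Finset.sum_pos' (fun x _ => mul_nonneg (M.m_pos x).le (sq_nonneg _))
        ⟨x, Finset.mem_univ x, mul_pos (M.m_pos x) (pow_pos (by simpa using hx) 2)⟩
    refine (mul_pos hε hpos).trans_le (he.trans_eq ?_)
    simp only [dotProduct, killedLaplacian_mulVec, star_trivial, mul_sub, Finset.mul_sum,
      Finset.sum_sub_distrib, Pi.zero_apply, add_zero]
    congr 1
    · exact Finset.sum_congr rfl fun x _ => by ring
    · exact Finset.sum_congr rfl fun x _ => Finset.sum_congr rfl fun y _ => by ring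
  rw [killedLaplacian_eq_add]
  exact h0.add_posSemidef (Matrix.PosSemidef.diagonal hθ)

/-- Maximum principle. Let w be the negative part of v. Where v ≤ 0, replacing -v by w at the other
sites can only lower the value of A_θ, because its off-diagonal entries are nonpositive; hence ⟨w,
A_θ w⟩ ≤ 0, which contradicts positive definiteness unless w = 0. -/
theorem MassGap.nonneg_of_killedLaplacian_mulVec_nonneg (hM : M.MassGap) {θ : X → ℝ}
    (hθ : ∀ x, 0 ≤ θ x) {v : X → ℝ} (hv : ∀ x, 0 ≤ (M.killedLaplacian θ).mulVec v x) (x : X) :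
    0 ≤ v x := by
  have hH := hM.posDef_killedLaplacian hθ
  by_contra hx
  have hw : (fun x => max (-v x) 0) ≠ 0 := fun h => by
    have := congrFun h x
    simp at this
    exact hx this
  have h1 := hH.dotProduct_mulVec_pos hw
  refine absurd h1 (not_lt.2 ?_)
  simp only [dotProduct, star_trivial]
  refine Finset.sum_nonpos fun x _ => ?_
  rcases le_total 0 (v x) with h | h
  · simp [h]
  · refine mul_nonpos_of_nonneg_of_nonpos (le_max_right _ _) ?_
    have := hv x
    rw [killedLaplacian_mulVec] at this ⊢
    rw [max_eq_left (by linarith)]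
    have hsum : -∑ y, M.conductance x y * v y ≤ ∑ y, M.conductance x y * max (-v y) 0 := by
      rw [← Finset.sum_neg_distrib]
      refine Finset.sum_le_sum fun y _ => ?_
      rw [← mul_neg]
      exact mul_le_mul_of_nonneg_left (le_max_left _ _) (M.conductance_nonneg x y)
    linarith

variable (M) in
theorem lintegral_pathMeasure_eq_pathGreen {θ : X → ℝ} (hθ : ∀ x, 0 ≤ θ x) (x y : X) :
    ∫⁻ γ, expNeg (∑ u, ENNReal.ofReal (θ u) * M.pathOccupation γ u) ∂(M.pathMeasure x y)
      = pathGreen (fun u v => ENNReal.ofReal (M.q u * M.P u v))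
          (fun u => ENNReal.ofReal (M.q u + θ u / M.m u)⁻¹) x y := by
  have hmeas : Measurable fun γ => expNeg (∑ u, ENNReal.ofReal (θ u) * M.pathOccupation γ u) :=
    measurable_expNeg.comp (Finset.measurable_fun_sum _ fun u _ =>
      (M.measurable_pathOccupation u).const_mul _)
  rw [pathMeasure, lintegral_sum_measure, ← tsum_discretePath]
  refine tsum_congr fun w => ?_
  rw [lintegral_map hmeas (ChainPath.measurable_mk w.1), M.lintegral_holdingMeasure hθ,
    jumpWeight, ENNReal.ofReal_prod_of_nonneg fun i _ => mul_nonneg (M.q_pos _).le (M.P_nonneg _ _)]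

/-- Since A_θ = M_m (q + θ/m - qP), the first-step equation for the path sum g reads A_θ g = M_m as
soon as g is finite. -/
theorem MassGap.lintegral_pathMeasure (hM : M.MassGap) {θ : X → ℝ} (hθ : ∀ x, 0 ≤ θ x) (x y : X) :
    ∫⁻ γ, expNeg (∑ u, ENNReal.ofReal (θ u) * M.pathOccupation γ u) ∂(M.pathMeasure x y)
      = ENNReal.ofReal ((M.killedLaplacian θ)⁻¹ x y * M.m y) := by
  rw [M.lintegral_pathMeasure_eq_pathGreen hθ]
  set Q : X → X → ℝ≥0∞ := fun u v => ENNReal.ofReal (M.q u * M.P u v) with hQ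
  set c : X → ℝ≥0∞ := fun u => ENNReal.ofReal (M.q u + θ u / M.m u)⁻¹ with hc
  have hH := hM.posDef_killedLaplacian hθ
  have hdet : IsUnit (M.killedLaplacian θ).det := hH.det_pos.ne'.isUnit
  have hpos (u : X) : 0 < M.q u + θ u / M.m u :=
    add_pos_of_pos_of_nonneg (M.q_pos u) (div_nonneg (hθ u) (M.m_pos u).le)
  have hqP (u v : X) : 0 ≤ M.q u * M.P u v := mul_nonneg (M.q_pos u).le (M.P_nonneg u v)
  have hlam (u : X) : M.lam u + θ u = M.m u * (M.q u + θ u / M.m u) := by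
    have := (M.m_pos u).ne'
    have hq := (M.q_pos u).ne'
    rw [mul_add, mul_div_cancel₀ _ this, m, div_mul_cancel₀ _ hq]
  have hcond (u v : X) : M.conductance u v = M.m u * (M.q u * M.P u v) := by
    have hq := (M.q_pos u).ne'
    rw [conductance, m]
    field_simp
  have hmul (z : X → ℝ) (u : X) : (M.killedLaplacian θ).mulVec z u
      = M.m u * ((M.q u + θ u / M.m u) * z u - ∑ v, M.q u * M.P u v * z v) := by
    rw [killedLaplacian_mulVec, hlam, mul_sub, Finset.mul_sum]
    simp only [hcond, mul_assoc]
  have hfin (u v : X) : pathGreen Q c u v ≠ ∞ := by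
    -- Solving A_θ b = m gives equality in the supersolution inequality, and b ≥ 0 by the maximum
    -- principle.
    let b : X → ℝ := (M.killedLaplacian θ)⁻¹.mulVec M.m
    have hb : (M.killedLaplacian θ).mulVec b = M.m := by
      rw [Matrix.mulVec_mulVec, Matrix.mul_nonsing_inv _ hdet, Matrix.one_mulVec]
    have hb0 : ∀ u, 0 ≤ b u := hM.nonneg_of_killedLaplacian_mulVec_nonneg hθ fun u => by
      rw [hb]
      exact (M.m_pos u).le
    refine ne_top_of_le_ne_top ENNReal.ofReal_ne_top
      (pathGreen_le Q c (v := fun u => ENNReal.ofReal (b u)) (fun u => ?_) u v)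
    have h1 := hmul b u
    rw [hb] at h1
    have h2 : (M.q u + θ u / M.m u) * b u - ∑ v, M.q u * M.P u v * b v = 1 := by
      have := M.m_pos u
      exact (mul_right_eq_self₀.1 h1.symm).resolve_right this.ne'
    simp only [hQ, hc]
    simp_rw [← ENNReal.ofReal_mul (hqP _ _)]
    rw [← ENNReal.ofReal_sum_of_nonneg fun v _ => mul_nonneg (hqP u v) (hb0 v),
      ← ENNReal.ofReal_one, ← ENNReal.ofReal_add zero_le_one
        (Finset.sum_nonneg fun v _ => mul_nonneg (hqP u v) (hb0 v)),
      ← ENNReal.ofReal_mul (inv_pos.2 (hpos u)).le]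
    refine ENNReal.ofReal_le_ofReal (le_of_eq ?_)
    rw [inv_mul_eq_iff_eq_mul₀ (hpos u).ne']
    linarith
  let g : Matrix X X ℝ := Matrix.of fun u v => (pathGreen Q c u v).toReal
  have hg (u v : X) : g u v = (if u = v then (M.q u + θ u / M.m u)⁻¹ else 0)
      + (M.q u + θ u / M.m u)⁻¹ * ∑ z, M.q u * M.P u z * g z v := by
    have h := congrArg ENNReal.toReal (pathGreen_eq Q c u v)
    have hsum : ∑ z, Q u z * pathGreen Q c z v ≠ ∞ :=
      ENNReal.sum_ne_top.2 fun z _ => ENNReal.mul_ne_top ENNReal.ofReal_ne_top (hfin z v)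
    rw [ENNReal.toReal_add (by split_ifs <;> simp [hc])
      (ENNReal.mul_ne_top ENNReal.ofReal_ne_top hsum), ENNReal.toReal_mul,
      ENNReal.toReal_sum fun z _ => ENNReal.mul_ne_top ENNReal.ofReal_ne_top (hfin z v)] at h
    simp only [ENNReal.toReal_mul, hQ, hc, ENNReal.toReal_ofReal (hqP _ _),
      ENNReal.toReal_ofReal (inv_pos.2 (hpos u)).le, apply_ite ENNReal.toReal,
      ENNReal.toReal_zero] at h
    exact h
  have hHg : M.killedLaplacian θ * g = Matrix.diagonal M.m := by
    ext u v
    have h1 : (M.killedLaplacian θ * g) u v = (M.killedLaplacian θ).mulVec (fun z => g z v) u := rfl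
    rw [h1, hmul, hg u v, mul_add, mul_inv_cancel_left₀ (hpos u).ne', add_sub_cancel_right,
      Matrix.diagonal_apply]
    split_ifs
    · rw [mul_inv_cancel₀ (hpos u).ne', mul_one]
    · simp
  have hginv : g = (M.killedLaplacian θ)⁻¹ * Matrix.diagonal M.m := by
    rw [← hHg, ← Matrix.mul_assoc, Matrix.nonsing_inv_mul _ hdet, Matrix.one_mul]
  rw [← Matrix.mul_diagonal, ← hginv]
  exact (ENNReal.ofReal_toReal (hfin x y)).symm

theorem MassGap.lintegral_bridgeMeasure (hM : M.MassGap) {θ : X → ℝ} (hθ : ∀ x, 0 ≤ θ x)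
    (x y : X) :
    ∫⁻ γ, expNeg (∑ u, ENNReal.ofReal (θ u) * M.pathOccupation γ u) ∂(M.bridgeMeasure x y)
      = ENNReal.ofReal ((M.killedLaplacian θ)⁻¹ x y) := by
  rw [bridgeMeasure, lintegral_smul_measure, hM.lintegral_pathMeasure hθ, smul_eq_mul,
    ← ENNReal.ofReal_inv_of_pos (M.m_pos y), ← ENNReal.ofReal_mul (inv_pos.2 (M.m_pos y)).le]
  congr 1
  have := (M.m_pos y).ne'
  field_simp

theorem MassGap.isFiniteMeasure_bridgeMeasure (hM : M.MassGap) (x y : X) :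
    IsFiniteMeasure (M.bridgeMeasure x y) := by
  refine ⟨?_⟩
  have h := hM.lintegral_bridgeMeasure (θ := 0) (fun _ => le_rfl) x y
  simp only [Pi.zero_apply, ENNReal.ofReal_zero, zero_mul, Finset.sum_const_zero, expNeg_zero,
    lintegral_one] at h
  rw [h]
  exact ENNReal.ofReal_lt_top

end SymmetricChain

/-! ### Simultaneous diagonalization -/

section Diagonalization

open Matrix

variable {n : Type*} [Fintype n] [DecidableEq n]

/-- An eigenbasis of K rescaled by the inverse square roots of the eigenvalues turns K into the
identity; an orthogonal change of basis then diagonalizes the transformed N without disturbing the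
identity. -/
theorem Matrix.PosDef.exists_simultaneous_diagonalization {K N : Matrix n n ℝ} (hK : K.PosDef)
    (hN : N.IsHermitian) : ∃ (B : Matrix n n ℝ) (d : n → ℝ),
      IsUnit B.det ∧ Bᵀ * K * B = 1 ∧ Bᵀ * N * B = diagonal d := by
  have diag {A : Matrix n n ℝ} (hA : A.IsHermitian) : ∃ V : Matrix n n ℝ, Vᵀ * V = 1 ∧
      Vᵀ * A * V = diagonal hA.eigenvalues := by
    refine ⟨hA.eigenvectorUnitary, (Matrix.mem_unitaryGroup_iff').1 hA.eigenvectorUnitary.2, ?_⟩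
    have h := hA.conjStarAlgAut_star_eigenvectorUnitary
    rwa [Unitary.conjStarAlgAut_star_apply] at h
  obtain ⟨V, -, hV⟩ := diag hK.1
  have hs (i : n) : (√(hK.1.eigenvalues i))⁻¹ * hK.1.eigenvalues i
      * (√(hK.1.eigenvalues i))⁻¹ = 1 := by
    have hpos := Real.sqrt_pos.2 (hK.eigenvalues_pos i)
    have hsq := Real.mul_self_sqrt (hK.eigenvalues_pos i).le
    field_simp
    linarith
  let W : Matrix n n ℝ := V * diagonal fun i => (√(hK.1.eigenvalues i))⁻¹
  have hW : Wᵀ * K * W = 1 := by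
    calc Wᵀ * K * W = (diagonal fun i => (√(hK.1.eigenvalues i))⁻¹) * (Vᵀ * K * V)
          * diagonal fun i => (√(hK.1.eigenvalues i))⁻¹ := by
          simp only [W, transpose_mul, diagonal_transpose, Matrix.mul_assoc]
      _ = 1 := by
          rw [hV, diagonal_mul_diagonal, diagonal_mul_diagonal]
          simp only [hs, diagonal_one]
  obtain ⟨U, hU, hNU⟩ := diag (isHermitian_conjTranspose_mul_mul W hN)
  have hB : (W * U)ᵀ * K * (W * U) = 1 := by
    calc (W * U)ᵀ * K * (W * U) = Uᵀ * (Wᵀ * K * W) * U := by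
          simp only [transpose_mul, Matrix.mul_assoc]
      _ = 1 := by rw [hW, Matrix.mul_one, hU]
  refine ⟨W * U, (isHermitian_conjTranspose_mul_mul W hN).eigenvalues,
    Matrix.isUnit_det_of_left_inverse hB, hB, ?_⟩
  rw [← hNU]
  simp only [transpose_mul, Matrix.mul_assoc, conjTranspose_eq_transpose_of_trivial]

theorem Matrix.inv_eq_of_transpose_mul_mul_eq_diagonal {A B : Matrix n n ℝ} {d : n → ℝ}
    (hB : IsUnit B.det) (hd : ∀ i, d i ≠ 0) (h : Bᵀ * A * B = diagonal d) :
    A⁻¹ = B * diagonal (fun i => (d i)⁻¹) * Bᵀ := by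
  have hBt : IsUnit Bᵀ.det := by rwa [det_transpose]
  have hA : A = Bᵀ⁻¹ * diagonal d * B⁻¹ := by
    rw [← h, Matrix.mul_assoc Bᵀ, ← Matrix.mul_assoc Bᵀ⁻¹, Matrix.nonsing_inv_mul _ hBt,
      Matrix.one_mul, Matrix.mul_assoc, Matrix.mul_nonsing_inv _ hB, Matrix.mul_one]
  refine Matrix.inv_eq_right_inv ?_
  rw [hA]
  calc Bᵀ⁻¹ * diagonal d * B⁻¹ * (B * diagonal (fun i => (d i)⁻¹) * Bᵀ)
      = Bᵀ⁻¹ * (diagonal d * (B⁻¹ * B) * diagonal (fun i => (d i)⁻¹)) * Bᵀ := by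
        simp only [Matrix.mul_assoc]
    _ = 1 := by
        rw [Matrix.nonsing_inv_mul _ hB, Matrix.mul_one, diagonal_mul_diagonal]
        simp [hd, Matrix.nonsing_inv_mul _ hBt]

end Diagonalization

/-! ### Occupation fields of loops -/

theorem Loop.timeSpent_mk {X : Type*} (b : BasedLoop X) (x : X) :
    Loop.timeSpent (Quotient.mk (BasedLoop.shiftSetoid X) b) x
      = _root_.timeSpent b.1.stateAt b.1.duration x := by
  change _root_.timeSpent b.traj b.period x = _
  refine setLIntegral_congr_fun measurableSet_Ico fun t ht => ?_
  simp only [BasedLoop.traj]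
  rw [(toIcoMod_eq_self b.period_pos).2 (by simpa using ht)]

namespace SymmetricChain

variable {X : Type*} [Fintype X] (M : SymmetricChain X)

theorem loopOccupation_mk (b : BasedLoop X) (x : X) :
    M.loopOccupation (Quotient.mk (BasedLoop.shiftSetoid X) b) x = M.pathOccupation b.1 x := by
  rw [loopOccupation, Loop.timeSpent_mk, pathOccupation]

theorem measurable_loopOccupation (x : X) : Measurable fun l => M.loopOccupation l x := by
  refine measurable_from_quotient.2 ?_
  have h : (fun l => M.loopOccupation l x) ∘ Quotient.mk''
      = fun b : BasedLoop X => M.pathOccupation b.1 x := funext fun b => M.loopOccupation_mk b x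
  rw [h]
  exact (M.measurable_pathOccupation x).comp measurable_subtype_coe

omit [Fintype X] in
theorem measurableSet_first_eq_last : MeasurableSet {γ : ChainPath X | γ.first = γ.last} :=
  ChainPath.measurableSet_iff.2 fun w => MeasurableSet.const (w.first = w.last)

theorem ae_pathMeasure (x y : X) : ∀ᵐ γ ∂(M.pathMeasure x y), γ.first = x ∧ γ.last = y := by
  have hs : MeasurableSet {γ : ChainPath X | γ.first = x ∧ γ.last = y} :=
    ChainPath.measurableSet_iff.2 fun w => MeasurableSet.const (w.first = x ∧ w.last = y)
  rw [pathMeasure, Measure.ae_sum_iff' hs]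
  intro w
  rw [ae_map_iff (ChainPath.measurable_mk w.1).aemeasurable hs]
  exact Filter.Eventually.of_forall fun s => w.2

theorem lintegral_loopMeasure {f : Loop X → ℝ≥0∞} (hf : Measurable f) {g : ChainPath X → ℝ≥0∞}
    (hg : Measurable g) (hfg : ∀ b : BasedLoop X, f (Quotient.mk (BasedLoop.shiftSetoid X) b) = g b.1) :
    ∫⁻ l, f l ∂M.loopMeasure
      = ∫⁻ γ, (ENNReal.ofReal γ.duration)⁻¹ * g γ ∂(∑ x, M.pathMeasure x x) := by
  have hd : Measurable fun b : BasedLoop X => (ENNReal.ofReal b.period)⁻¹ :=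
    (ENNReal.measurable_ofReal.comp
      (ChainPath.measurable_duration.comp measurable_subtype_coe)).inv
  have hmk : Measurable (Quotient.mk (BasedLoop.shiftSetoid X)) := fun _ hs => hs
  rw [loopMeasure, lintegral_map hf hmk]
  simp only [hfg]
  have hg' : Measurable fun b : BasedLoop X => g b.1 := hg.comp measurable_subtype_coe
  rw [basedLoopMeasure, lintegral_withDensity_eq_lintegral_mul _ hd hg']
  have h := lintegral_subtype_comap (μ := ∑ x, M.pathMeasure x x) measurableSet_first_eq_last
    (fun γ => (ENNReal.ofReal γ.duration)⁻¹ * g γ)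
  refine h.trans ?_
  -- Passing to based loops loses no mass: the measure with endpoints x and x is carried by closed
  -- paths.
  rw [Measure.restrict_eq_self_of_ae_mem]
  rw [← Measure.sum_fintype]
  refine (Measure.ae_sum_iff' measurableSet_first_eq_last).2 ?_
  intro x
  filter_upwards [M.ae_pathMeasure x x] with γ hγ
  exact hγ.1.trans hγ.2.symm

/-- The m-weighted total occupation is the duration, so e^{-αT} is itself a Laplace functional of
the occupation field; this is what makes the weight 1/T tractable. -/
theorem expNeg_sum_mul_m_mul_pathOccupation {α : ℝ} (hα : 0 ≤ α) (γ : ChainPath X) :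
    expNeg (∑ x, ENNReal.ofReal (α * M.m x) * M.pathOccupation γ x)
      = ENNReal.ofReal (Real.exp (-(γ.duration * α))) := by
  rw [M.expNeg_sum_mul_pathOccupation fun x => mul_nonneg hα (M.m_pos x).le,
    ← ENNReal.ofReal_prod_of_nonneg fun i _ => (Real.exp_pos _).le, ← Real.exp_sum]
  congr 2
  rw [ChainPath.duration, Finset.sum_mul, ← Finset.sum_neg_distrib]
  refine Finset.sum_congr rfl fun i _ => ?_
  have := (M.m_pos (γ.1.2 i)).ne'
  field_simp

end SymmetricChain

/-! ### The Laplace functional of the loop measure -/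

/-- The integrand has antiderivative ∑ log (a_i + t) - ∑ log (b_i + t), which tends to 0 at infinity
because both families have the same index set. The order hypothesis makes the integrand nonnegative,
hence integrable. -/
theorem lintegral_Ioi_sum_inv_sub {ι : Type*} [Fintype ι] {a b : ι → ℝ} (ha : ∀ i, 0 < a i)
    (hb : ∀ i, 0 < b i) (hab : ∀ t, 0 < t → ∑ i, (b i + t)⁻¹ ≤ ∑ i, (a i + t)⁻¹) :
    expNeg (∫⁻ t in Set.Ioi (0 : ℝ), ENNReal.ofReal (∑ i, (a i + t)⁻¹ - ∑ i, (b i + t)⁻¹))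
      = ENNReal.ofReal ((∏ i, a i) / ∏ i, b i) := by
  let f : ℝ → ℝ := fun t => ∑ i, Real.log (a i + t) - ∑ i, Real.log (b i + t)
  have hderiv1 {c : ι → ℝ} (hc : ∀ i, 0 < c i) (t : ℝ) (ht : 0 ≤ t) :
      HasDerivAt (fun t => ∑ i, Real.log (c i + t)) (∑ i, (c i + t)⁻¹) t := by
    refine HasDerivAt.fun_sum fun i _ => ?_
    have h := ((hasDerivAt_id t).const_add (c i)).log (add_pos_of_pos_of_nonneg (hc i) ht).ne'
    simpa using h
  have hderiv : ∀ t ∈ Set.Ici (0 : ℝ),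
      HasDerivAt f (∑ i, (a i + t)⁻¹ - ∑ i, (b i + t)⁻¹) t := fun t ht =>
    (hderiv1 ha t ht).sub (hderiv1 hb t ht)
  have hpos : ∀ t ∈ Set.Ioi (0 : ℝ), 0 ≤ ∑ i, (a i + t)⁻¹ - ∑ i, (b i + t)⁻¹ := fun t ht =>
    sub_nonneg.2 (hab t ht)
  have hlim : Filter.Tendsto f Filter.atTop (nhds 0) := by
    have h1 (i : ι) : Filter.Tendsto (fun t => Real.log (a i + t) - Real.log (b i + t))
        Filter.atTop (nhds 0) := by
      have h2 : Filter.Tendsto (fun t => (a i - b i) * (b i + t)⁻¹ + 1) Filter.atTop (nhds 1) := by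
        have := (tendsto_inv_atTop_zero.comp
          (Filter.tendsto_atTop_add_const_left Filter.atTop (b i) Filter.tendsto_id)).const_mul
            (a i - b i)
        simpa using this.add_const 1
      have h3 := h2.log one_ne_zero
      rw [Real.log_one] at h3
      refine h3.congr' ?_
      filter_upwards [Filter.eventually_gt_atTop 0] with t ht
      have hat : 0 < a i + t := add_pos (ha i) ht
      have hbt : 0 < b i + t := add_pos (hb i) ht
      rw [← Real.log_div hat.ne' hbt.ne']
      congr 1
      field_simp
      ring
    have h := tendsto_finsetSum Finset.univ fun i _ => h1 i
    simpa only [Finset.sum_sub_distrib, Finset.sum_const_zero] using h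
  have hint := integral_Ioi_of_hasDerivAt_of_nonneg' hderiv hpos hlim
  have hintegrable := integrableOn_Ioi_deriv_of_nonneg' hderiv hpos hlim
  have hnonneg : 0 ≤ ∫ t in Set.Ioi (0 : ℝ), (∑ i, (a i + t)⁻¹ - ∑ i, (b i + t)⁻¹) :=
    setIntegral_nonneg measurableSet_Ioi hpos
  rw [← ofReal_integral_eq_lintegral_ofReal hintegrable
    ((ae_restrict_iff' measurableSet_Ioi).2 (Filter.Eventually.of_forall hpos)),
    expNeg_ofReal hnonneg, hint]
  congr 1
  have hA : 0 < ∏ i, a i := Finset.prod_pos fun i _ => ha i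
  have hB : 0 < ∏ i, b i := Finset.prod_pos fun i _ => hb i
  simp only [f, add_zero]
  rw [← Real.log_prod fun i _ => (ha i).ne', ← Real.log_prod fun i _ => (hb i).ne',
    ← Real.log_div hA.ne' hB.ne', zero_sub, neg_neg, Real.exp_log (div_pos hA hB)]

namespace SymmetricChain

variable {X : Type*} [Fintype X] [DecidableEq X] {M : SymmetricChain X}

/-- The μ_i are the eigenvalues of A_χ relative to M_m. Adding αM_m shifts them all by α, so one
basis computes the trace of (A_χ + αM_m)⁻¹ M_m for every α. -/
theorem MassGap.exists_eigenvalues (hM : M.MassGap) {χ : X → ℝ} (hχ : ∀ x, 0 ≤ χ x) :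
    ∃ μ : X → ℝ, (∀ i, 0 < μ i) ∧ ∏ i, μ i = (M.killedLaplacian χ).det / ∏ x, M.m x ∧
      ∀ α, 0 ≤ α → ∑ x, (M.killedLaplacian fun x => α * M.m x + χ x)⁻¹ x x * M.m x
        = ∑ i, (μ i + α)⁻¹ := by
  have hH := hM.posDef_killedLaplacian hχ
  obtain ⟨B, μ, hB, hD, hμ⟩ := (Matrix.PosDef.diagonal
    (d := M.m) M.m_pos).exists_simultaneous_diagonalization hH.1
  have hpos (i : X) : 0 < μ i := by
    have hB' : Function.Injective B.mulVec :=
      Matrix.mulVec_injective_of_isUnit ((Matrix.isUnit_iff_isUnit_det B).2 hB)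
    have h := hH.conjTranspose_mul_mul_same hB'
    rw [Matrix.conjTranspose_eq_transpose_of_trivial, hμ] at h
    exact Matrix.posDef_diagonal_iff.1 h i
  refine ⟨μ, hpos, ?_, fun α hα => ?_⟩
  · have h1 := congrArg Matrix.det hD
    have h2 := congrArg Matrix.det hμ
    simp only [Matrix.det_mul, Matrix.det_transpose, Matrix.det_diagonal, Matrix.det_one] at h1 h2
    have hm : ∏ x, M.m x ≠ 0 := (Finset.prod_pos fun x _ => M.m_pos x).ne'
    rw [← h2, eq_div_iff hm]
    linear_combination (M.killedLaplacian χ).det * h1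
  · have hsplit : (M.killedLaplacian fun x => α * M.m x + χ x)
        = M.killedLaplacian χ + α • Matrix.diagonal M.m := by
      rw [M.killedLaplacian_eq_add χ, M.killedLaplacian_eq_add, add_assoc, ← Matrix.diagonal_smul,
        Matrix.diagonal_add]
      congr 2
      ext x
      simp [add_comm]
    have hdiag : B.transpose * (M.killedLaplacian fun x => α * M.m x + χ x) * B
        = Matrix.diagonal fun i => μ i + α := by
      rw [hsplit, Matrix.mul_add, Matrix.add_mul, hμ, Matrix.mul_smul, Matrix.smul_mul, hD,
        ← Matrix.diagonal_one, ← Matrix.diagonal_smul, Matrix.diagonal_add]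
      congr 1
      ext i
      simp
    rw [Matrix.inv_eq_of_transpose_mul_mul_eq_diagonal hB
      (fun i => (add_pos_of_pos_of_nonneg (hpos i) hα).ne') hdiag]
    set R := Matrix.diagonal fun i => (μ i + α)⁻¹ with hR
    have htr : ∑ x, (B * R * B.transpose) x x * M.m x
        = (B * R * B.transpose * Matrix.diagonal M.m).trace := by
      simp only [Matrix.trace, Matrix.diag_apply, Matrix.mul_diagonal]
    rw [htr, Matrix.mul_assoc, Matrix.mul_assoc, Matrix.trace_mul_comm, Matrix.mul_assoc, hD,
      Matrix.mul_one, hR, Matrix.trace_diagonal]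

/-- After writing 1/T = ∫ e^{-αT} dα and exchanging integrals, the integrand in α is the trace for
killing αm minus that for αm + χ. The subtraction is made at fixed α, where both terms are finite,
since for nonempty X each trace alone is not integrable in α. -/
theorem MassGap.expNeg_lintegral_loopMeasure (hM : M.MassGap) {χ : X → ℝ} (hχ : ∀ x, 0 ≤ χ x) :
    expNeg (∫⁻ l, 1 - expNeg (∑ x, ENNReal.ofReal (χ x) * M.loopOccupation l x) ∂M.loopMeasure)
      = ENNReal.ofReal ((M.killedLaplacian 0).det / (M.killedLaplacian χ).det) := by
  set π : Measure (ChainPath X) := ∑ x, M.pathMeasure x x with hπ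
  let E : (X → ℝ) → ChainPath X → ℝ≥0∞ := fun θ γ =>
    expNeg (∑ x, ENNReal.ofReal (θ x) * M.pathOccupation γ x)
  have hE (θ : X → ℝ) : Measurable (E θ) :=
    measurable_expNeg.comp (Finset.measurable_fun_sum _ fun u _ =>
      (M.measurable_pathOccupation u).const_mul _)
  have hπE {θ : X → ℝ} (hθ : ∀ x, 0 ≤ θ x) : ∫⁻ γ, E θ γ ∂π
      = ENNReal.ofReal (∑ x, (M.killedLaplacian θ)⁻¹ x x * M.m x) := by
    rw [hπ, lintegral_finsetSum_measure, ENNReal.ofReal_sum_of_nonneg]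
    · exact Finset.sum_congr rfl fun x _ => hM.lintegral_pathMeasure hθ x x
    · exact fun x _ => mul_nonneg (hM.posDef_killedLaplacian hθ).inv.posSemidef.diag_nonneg
        (M.m_pos x).le
  have hfin : IsFiniteMeasure π := by
    refine ⟨?_⟩
    have h := hπE (θ := 0) fun _ => le_rfl
    simp only [E, Pi.zero_apply, ENNReal.ofReal_zero, zero_mul, Finset.sum_const_zero, expNeg_zero,
      lintegral_one] at h
    rw [h]
    exact ENNReal.ofReal_lt_top
  obtain ⟨a, ha, haprod, hatr⟩ := hM.exists_eigenvalues (χ := 0) fun _ => le_rfl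
  obtain ⟨b, hb, hbprod, hbtr⟩ := hM.exists_eigenvalues hχ
  have hαm {α : ℝ} (hα : 0 ≤ α) (x : X) : 0 ≤ α * M.m x := mul_nonneg hα (M.m_pos x).le
  have hmul {α : ℝ} (hα : 0 ≤ α) (γ : ChainPath X) :
      E (fun x => α * M.m x + χ x) γ = E (fun x => α * M.m x) γ * E χ γ := by
    simp only [E]
    rw [← expNeg_add, ← Finset.sum_add_distrib]
    simp only [ENNReal.ofReal_add (hαm hα _) (hχ _), add_mul]
  have hle {α : ℝ} (hα : 0 ≤ α) (γ : ChainPath X) :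
      E (fun x => α * M.m x + χ x) γ ≤ E (fun x => α * M.m x) γ := by
    rw [hmul hα]
    exact mul_le_of_le_one_right' (expNeg_le_one _)
  have hA {α : ℝ} (hα : 0 ≤ α) : ∫⁻ γ, E (fun x => α * M.m x) γ ∂π
      = ENNReal.ofReal (∑ i, (a i + α)⁻¹) := by
    rw [← hatr α hα, hπE (hαm hα)]
    simp
  have hB {α : ℝ} (hα : 0 ≤ α) : ∫⁻ γ, E (fun x => α * M.m x + χ x) γ ∂π
      = ENNReal.ofReal (∑ i, (b i + α)⁻¹) := by
    rw [← hbtr α hα, hπE fun x => add_nonneg (hαm hα x) (hχ x)]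
  have hBnn {α : ℝ} (hα : 0 ≤ α) : 0 ≤ ∑ i, (b i + α)⁻¹ :=
    Finset.sum_nonneg fun i _ => inv_nonneg.2 (add_nonneg (hb i).le hα)
  have hAnn {α : ℝ} (hα : 0 ≤ α) : 0 ≤ ∑ i, (a i + α)⁻¹ :=
    Finset.sum_nonneg fun i _ => inv_nonneg.2 (add_nonneg (ha i).le hα)
  -- The traces are compared through the path integrals they represent, so no ordering of the
  -- eigenvalues is needed.
  have hab (α : ℝ) (hα : 0 < α) : ∑ i, (b i + α)⁻¹ ≤ ∑ i, (a i + α)⁻¹ := by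
    rw [← ENNReal.ofReal_le_ofReal_iff (hAnn hα.le), ← hA hα.le, ← hB hα.le]
    exact lintegral_mono (hle hα.le)
  have hmeas1 : Measurable fun l : Loop X =>
      1 - expNeg (∑ x, ENNReal.ofReal (χ x) * M.loopOccupation l x) :=
    measurable_const.sub (measurable_expNeg.comp (Finset.measurable_fun_sum _ fun u _ =>
      (M.measurable_loopOccupation u).const_mul _))
  have hmeas2 : Measurable fun γ => 1 - E χ γ := measurable_const.sub (hE χ)
  have hker : Measurable fun p : ChainPath X × ℝ =>
      ENNReal.ofReal (Real.exp (-(p.1.duration * p.2))) := by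
    have := ChainPath.measurable_duration (X := X)
    fun_prop
  have hloop : ∫⁻ l, 1 - expNeg (∑ x, ENNReal.ofReal (χ x) * M.loopOccupation l x) ∂M.loopMeasure
      = ∫⁻ α in Set.Ioi (0 : ℝ), ENNReal.ofReal (∑ i, (a i + α)⁻¹ - ∑ i, (b i + α)⁻¹) := by
    rw [M.lintegral_loopMeasure hmeas1 hmeas2 fun b => by simp only [loopOccupation_mk, E]]
    have h1 (γ : ChainPath X) : (ENNReal.ofReal γ.duration)⁻¹ * (1 - E χ γ)
        = ∫⁻ α in Set.Ioi (0 : ℝ),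
          ENNReal.ofReal (Real.exp (-(γ.duration * α))) * (1 - E χ γ) := by
      rw [lintegral_mul_const _ (by fun_prop), lintegral_exp_neg_mul γ.duration_pos,
        ENNReal.ofReal_inv_of_pos γ.duration_pos]
    simp only [h1]
    rw [lintegral_lintegral_swap
      (hker.mul (hmeas2.comp measurable_fst)).aemeasurable]
    refine setLIntegral_congr_fun measurableSet_Ioi fun α hα => ?_
    have hα0 : 0 ≤ α := le_of_lt hα
    have h2 (γ : ChainPath X) : ENNReal.ofReal (Real.exp (-(γ.duration * α))) * (1 - E χ γ)
        = E (fun x => α * M.m x) γ - E (fun x => α * M.m x + χ x) γ := by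
      rw [← M.expNeg_sum_mul_m_mul_pathOccupation hα0, hmul hα0,
        ENNReal.mul_sub fun _ _ => expNeg_ne_top _, mul_one]
    simp only [h2]
    rw [lintegral_sub (hE _) (by rw [hB hα0]; exact ENNReal.ofReal_ne_top)
      (Filter.Eventually.of_forall (hle hα0)), hA hα0, hB hα0, ← ENNReal.ofReal_sub _ (hBnn hα0)]
  rw [hloop, lintegral_Ioi_sum_inv_sub ha hb hab, haprod, hbprod]
  congr 1
  have hm : ∏ x, M.m x ≠ 0 := (Finset.prod_pos fun x _ => M.m_pos x).ne'
  rw [div_div_div_cancel_right₀ hm]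

end SymmetricChain

/-! ### Gaussian integrals -/

theorem gaussianPDFReal_mul_exp {c : ℝ} (hc : 0 ≤ c) (t : ℝ) :
    gaussianPDFReal 0 1 t * Real.exp (-(c * t ^ 2 / 2))
      = (√(1 + c))⁻¹ * gaussianPDFReal 0 (Real.toNNReal (1 + c)⁻¹) t := by
  have hc1 : 0 < 1 + c := by linarith
  rw [gaussianPDFReal, gaussianPDFReal, Real.coe_toNNReal _ (inv_pos.2 hc1).le, mul_assoc,
    ← Real.exp_add, ← mul_assoc, ← mul_inv, ← Real.sqrt_mul hc1.le]
  congr 3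
  · simp only [NNReal.coe_one]
    field_simp
  · simp only [NNReal.coe_one]
    field_simp
    ring

/-- Exponential tilting: the weight turns variance 1 into variance 1/(1 + c), at the cost of the
normalizing factor (1 + c)^{-1/2}. -/
theorem integral_mul_exp_gaussianReal {c : ℝ} (hc : 0 ≤ c) (f : ℝ → ℝ) :
    ∫ t, f t * Real.exp (-(c * t ^ 2 / 2)) ∂(gaussianReal 0 1)
      = (√(1 + c))⁻¹ * ∫ t, f t ∂(gaussianReal 0 (Real.toNNReal (1 + c)⁻¹)) := by
  have hc1 : 0 < (1 + c)⁻¹ := inv_pos.2 (by linarith)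
  rw [integral_gaussianReal_eq_integral_smul one_ne_zero,
    integral_gaussianReal_eq_integral_smul (Real.toNNReal_pos.2 hc1).ne', ← integral_const_mul]
  refine integral_congr_ae (Filter.Eventually.of_forall fun t => ?_)
  simp only [smul_eq_mul]
  linear_combination f t * gaussianPDFReal_mul_exp hc t

theorem integral_mul_mul_prod_exp {Ω J : Type*} [MeasurableSpace Ω] [Fintype J] [DecidableEq J]
    {Pr : Measure Ω} {u : J → Ω → ℝ} (hu : iIndepFun u Pr) (hm : ∀ j, AEMeasurable (u j) Pr)
    (hlaw : ∀ j, Pr.map (u j) = gaussianReal 0 1) {c : J → ℝ} (hc : ∀ j, 0 ≤ c j) (j k : J) :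
    ∫ ω, u j ω * u k ω * ∏ l, Real.exp (-(c l * u l ω ^ 2 / 2)) ∂Pr
      = (if j = k then (1 + c j)⁻¹ else 0) * ∏ l, (√(1 + c l))⁻¹ := by
  -- This spreads u_j u_k over the independent coordinates, covering j = k and j ≠ k at once: the
  -- factor at j is then a second moment or a vanishing first moment.
  let f : J → ℝ → ℝ := fun l t => (if l = j then t else 1) * (if l = k then t else 1)
  have hf (l : J) : Measurable (f l) := by
    simp only [f]
    split_ifs <;> fun_prop
  have h1 (ω : Ω) : u j ω * u k ω * ∏ l, Real.exp (-(c l * u l ω ^ 2 / 2))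
      = ∏ l, f l (u l ω) * Real.exp (-(c l * u l ω ^ 2 / 2)) := by
    simp only [f, Finset.prod_mul_distrib, Finset.prod_ite_eq', Finset.mem_univ, if_true]
  simp only [h1]
  rw [hu.integral_fun_prod_comp hm (f := fun l t => f l t * Real.exp (-(c l * t ^ 2 / 2)))
    fun l => by have := hf l; fun_prop]
  have h2 (l : J) : ∫ ω, f l (u l ω) * Real.exp (-(c l * u l ω ^ 2 / 2)) ∂Pr
      = (√(1 + c l))⁻¹ * ∫ t, f l t ∂(gaussianReal 0 (Real.toNNReal (1 + c l)⁻¹)) := by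
    rw [← integral_mul_exp_gaussianReal (hc l), ← hlaw l, integral_map (hm l)]
    have := hf l
    fun_prop
  simp only [h2]
  rw [Finset.prod_mul_distrib, mul_comm]
  congr 1
  split_ifs with hjk
  · subst hjk
    rw [Finset.prod_eq_single j]
    · simp only [f, if_true]
      have hv := variance_of_integral_eq_zero
        (μ := gaussianReal 0 (Real.toNNReal (1 + c j)⁻¹)) (X := fun t => t)
        aemeasurable_id integral_id_gaussianReal
      rw [variance_fun_id_gaussianReal] at hv
      simp only [← sq]
      rw [← hv, Real.coe_toNNReal _ (inv_nonneg.2 (by linarith [hc j]))]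
    · intro l _ hl
      simp [f, hl]
    · simp
  · refine Finset.prod_eq_zero (Finset.mem_univ j) ?_
    simp [f, hjk]

theorem integral_prod_exp {Ω J : Type*} [MeasurableSpace Ω] [Fintype J]
    {Pr : Measure Ω} {u : J → Ω → ℝ} (hu : iIndepFun u Pr) (hm : ∀ j, AEMeasurable (u j) Pr)
    (hlaw : ∀ j, Pr.map (u j) = gaussianReal 0 1) {c : J → ℝ} (hc : ∀ j, 0 ≤ c j) :
    ∫ ω, ∏ l, Real.exp (-(c l * u l ω ^ 2 / 2)) ∂Pr = ∏ l, (√(1 + c l))⁻¹ := by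
  rw [hu.integral_fun_prod_comp hm (f := fun l t => Real.exp (-(c l * t ^ 2 / 2)))
    fun l => by fun_prop]
  refine Finset.prod_congr rfl fun l _ => ?_
  have h := integral_mul_exp_gaussianReal (hc l) fun _ => 1
  simp only [one_mul, integral_const, probReal_univ, smul_eq_mul, mul_one] at h
  rw [← h, ← hlaw l, integral_map (hm l) (by fun_prop)]

/-! ### Standard real coordinates of the complex field and its Laplace transforms -/

namespace SymmetricChain

variable {X : Type*} [Fintype X] [DecidableEq X] {M : SymmetricChain X}
  {Ω : Type*} [MeasurableSpace Ω] {Pr : Measure Ω} {φ : Ω → X → ℂ}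

theorem IsGaussianField.hasGaussianLaw_eval (hφ : M.IsGaussianField φ Pr) (x : X) :
    HasGaussianLaw (fun ω => φ ω x) Pr := hφ.gaussian.eval x

theorem IsGaussianField.integrable_mul (hφ : M.IsGaussianField φ Pr) (x y : X) :
    Integrable (fun ω => φ ω x * φ ω y) Pr :=
  (hφ.hasGaussianLaw_eval x).memLp_two.integrable_mul (hφ.hasGaussianLaw_eval y).memLp_two

theorem IsGaussianField.integrable_mul_conj (hφ : M.IsGaussianField φ Pr) (x y : X) :
    Integrable (fun ω => φ ω x * conj (φ ω y)) Pr :=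
  (hφ.hasGaussianLaw_eval x).memLp_two.integrable_mul (hφ.hasGaussianLaw_eval y).memLp_two.star

/-- The field obtained from `φ` by the linear map with matrix `V`. -/
def linearImage (V : Matrix X X ℝ) (φ : Ω → X → ℂ) (i : X) (ω : Ω) : ℂ := ∑ x, (V i x : ℂ) * φ ω x

theorem IsGaussianField.linearImage_moments (hφ : M.IsGaussianField φ Pr) (V : Matrix X X ℝ)
    (i j : X) :
    Integrable (fun ω => linearImage V φ i ω * linearImage V φ j ω) Pr ∧
    Integrable (fun ω => linearImage V φ i ω * conj (linearImage V φ j ω)) Pr ∧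
    ∫ ω, linearImage V φ i ω * linearImage V φ j ω ∂Pr = 0 ∧
    ∫ ω, linearImage V φ i ω * conj (linearImage V φ j ω) ∂Pr
      = 2 * ((V * M.green * V.transpose) i j : ℝ) := by
  have h1 (ω : Ω) : linearImage V φ i ω * linearImage V φ j ω
      = ∑ x, ∑ y, (V i x * V j y : ℂ) * (φ ω x * φ ω y) := by
    simp only [linearImage, Finset.sum_mul_sum]
    exact Finset.sum_congr rfl fun x _ => Finset.sum_congr rfl fun y _ => by ring
  have h2 (ω : Ω) : linearImage V φ i ω * conj (linearImage V φ j ω)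
      = ∑ x, ∑ y, (V i x * V j y : ℂ) * (φ ω x * conj (φ ω y)) := by
    simp only [linearImage, map_sum, map_mul, Complex.conj_ofReal, Finset.sum_mul_sum]
    exact Finset.sum_congr rfl fun x _ => Finset.sum_congr rfl fun y _ => by ring
  have i1 (x y : X) : Integrable (fun ω => (V i x * V j y : ℂ) * (φ ω x * φ ω y)) Pr :=
    (hφ.integrable_mul x y).const_mul _
  have i2 (x y : X) : Integrable (fun ω => (V i x * V j y : ℂ) * (φ ω x * conj (φ ω y))) Pr :=
    (hφ.integrable_mul_conj x y).const_mul _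
  have j1 (x : X) : Integrable (fun ω => ∑ y, (V i x * V j y : ℂ) * (φ ω x * φ ω y)) Pr :=
    integrable_finsetSum _ fun y _ => i1 x y
  have j2 (x : X) : Integrable (fun ω => ∑ y, (V i x * V j y : ℂ) * (φ ω x * conj (φ ω y))) Pr :=
    integrable_finsetSum _ fun y _ => i2 x y
  simp only [h1, h2]
  refine ⟨integrable_finsetSum _ fun x _ => j1 x, integrable_finsetSum _ fun x _ => j2 x, ?_, ?_⟩
  · rw [integral_finsetSum _ fun x _ => j1 x]
    refine Finset.sum_eq_zero fun x _ => ?_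
    rw [integral_finsetSum _ fun y _ => i1 x y]
    refine Finset.sum_eq_zero fun y _ => ?_
    rw [integral_const_mul, hφ.circular, mul_zero]
  · rw [integral_finsetSum _ fun x _ => j2 x]
    simp only [integral_finsetSum _ fun y _ => i2 _ y, integral_const_mul, hφ.covariance,
      Matrix.mul_apply, Matrix.transpose_apply, Finset.sum_mul]
    rw [Finset.sum_comm]
    push_cast
    simp only [Finset.mul_sum]
    exact Finset.sum_congr rfl fun x _ => Finset.sum_congr rfl fun y _ => by ring

theorem IsGaussianField.linearImage_mean (hφ : M.IsGaussianField φ Pr) (V : Matrix X X ℝ) (i : X) :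
    Integrable (linearImage V φ i) Pr ∧ ∫ ω, linearImage V φ i ω ∂Pr = 0 := by
  have h (x : X) : Integrable (fun ω => (V i x : ℂ) * φ ω x) Pr :=
    (hφ.hasGaussianLaw_eval x).integrable.const_mul _
  refine ⟨integrable_finsetSum _ fun x _ => h x, ?_⟩
  simp only [linearImage]
  rw [integral_finsetSum _ fun x _ => h x]
  refine Finset.sum_eq_zero fun x _ => ?_
  rw [integral_const_mul, hφ.mean_zero, mul_zero]

/-- The real and imaginary parts of the field `linearImage V φ`. -/
def realCoords (V : Matrix X X ℝ) (φ : Ω → X → ℂ) : X ⊕ X → Ω → ℝ :=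
  Sum.elim (fun i ω => (linearImage V φ i ω).re) (fun i ω => (linearImage V φ i ω).im)

theorem IsGaussianField.hasGaussianLaw_realCoords (hφ : M.IsGaussianField φ Pr)
    (V : Matrix X X ℝ) : HasGaussianLaw (fun ω j => realCoords V φ j ω) Pr := by
  let L (i : X) : (X → ℂ) →L[ℝ] ℂ := ∑ x, (V i x) • ContinuousLinearMap.proj x
  let T : (X → ℂ) →L[ℝ] (X ⊕ X → ℝ) := ContinuousLinearMap.pi
    (Sum.elim (fun i => Complex.reCLM.comp (L i)) (fun i => Complex.imCLM.comp (L i)))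
  have hL (i : X) (ω : Ω) : L i (φ ω) = linearImage V φ i ω := by
    simp [L, linearImage]
  have hT : (fun ω j => realCoords V φ j ω) = fun ω => T (φ ω) := by
    funext ω j
    rcases j with i | i
    · simp only [T, ContinuousLinearMap.coe_pi', Sum.elim_inl, ContinuousLinearMap.comp_apply, hL]
      rfl
    · simp only [T, ContinuousLinearMap.coe_pi', Sum.elim_inr, ContinuousLinearMap.comp_apply, hL]
      rfl
  rw [hT]
  exact hφ.gaussian.map_fun T

theorem IsGaussianField.integral_realCoords (hφ : M.IsGaussianField φ Pr) (V : Matrix X X ℝ)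
    (j : X ⊕ X) : ∫ ω, realCoords V φ j ω ∂Pr = 0 := by
  rcases j with i | i
  · have h := hφ.linearImage_mean V i
    change ∫ ω, RCLike.re (linearImage V φ i ω) ∂Pr = 0
    rw [integral_re h.1, h.2]
    simp
  · have h := hφ.linearImage_mean V i
    change ∫ ω, RCLike.im (linearImage V φ i ω) ∂Pr = 0
    rw [integral_im h.1, h.2]
    simp

/-- The moments E(zw) = 0 and E(z w̄) = 2δ determine all real covariances, via zw + z w̄ = 2 z Re w
and Re(z w̄ - zw) = 2 Im z Im w. The factor 2 in the covariance is what gives each real coordinate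
unit variance. -/
theorem IsGaussianField.integral_realCoords_mul (hφ : M.IsGaussianField φ Pr) {V : Matrix X X ℝ}
    (hV : V * M.green * V.transpose = 1) (j k : X ⊕ X) :
    ∫ ω, realCoords V φ j ω * realCoords V φ k ω ∂Pr = if j = k then 1 else 0 := by
  have key (i l : X) : (∫ ω, (linearImage V φ i ω).re * (linearImage V φ l ω).re ∂Pr
        = if i = l then 1 else 0)
      ∧ (∫ ω, (linearImage V φ i ω).im * (linearImage V φ l ω).im ∂Pr = if i = l then 1 else 0)
      ∧ ∫ ω, (linearImage V φ i ω).im * (linearImage V φ l ω).re ∂Pr = 0 := by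
    obtain ⟨h1, h2, h3, h4⟩ := hφ.linearImage_moments V i l
    rw [hV, Matrix.one_apply] at h4
    have hadd := integral_add h1 h2
    have hsub := integral_sub h2 h1
    rw [h3, h4] at hadd hsub
    have hre : ∀ z w : ℂ, (z * w + z * conj w) = ((2 * (z.re * w.re) : ℝ) : ℂ)
        + ((2 * (z.im * w.re) : ℝ) : ℂ) * Complex.I := fun z w => by
      apply Complex.ext <;> simp <;> ring
    have him : ∀ z w : ℂ, (z * conj w - z * w).re = 2 * (z.im * w.im) := fun z w => by
      simp; ring
    have hre' := (integral_re (h1.add h2)).trans (congrArg RCLike.re hadd)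
    have him' := (integral_im (h1.add h2)).trans (congrArg RCLike.im hadd)
    have hsub' := (integral_re (h2.sub h1)).trans (congrArg RCLike.re hsub)
    simp only [Pi.add_apply, Pi.sub_apply] at hre' him' hsub'
    simp only [RCLike.re_eq_complex_re, him] at hsub'
    simp only [RCLike.re_eq_complex_re, RCLike.im_eq_complex_im, hre] at hre' him'
    simp only [Complex.add_re, Complex.add_im, Complex.re_ofReal_mul, Complex.im_ofReal_mul,
      Complex.I_re, Complex.I_im, Complex.ofReal_re, Complex.ofReal_im, mul_zero, mul_one, add_zero,
      zero_add, integral_const_mul] at hre' him' hsub'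
    refine ⟨?_, ?_, ?_⟩
    · split_ifs at hre' ⊢ <;> simp at hre' <;> linarith
    · split_ifs at hsub' ⊢ <;> simp at hsub' <;> linarith
    · split_ifs at him' <;> simp at him' <;> linarith
  rcases j with i | i <;> rcases k with l | l
  · simpa [realCoords] using (key i l).1
  · simpa [realCoords, mul_comm] using (key l i).2.2
  · simpa [realCoords] using (key i l).2.2
  · simpa [realCoords] using (key i l).2.1

theorem IsGaussianField.realCoords_standard (hφ : M.IsGaussianField φ Pr) {V : Matrix X X ℝ}
    (hV : V * M.green * V.transpose = 1) :
    iIndepFun (realCoords V φ) Pr ∧ (∀ j, AEMeasurable (realCoords V φ j) Pr) ∧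
      ∀ j, Pr.map (realCoords V φ j) = gaussianReal 0 1 := by
  have hG := hφ.hasGaussianLaw_realCoords V
  have := hG.isProbabilityMeasure
  have hGj (j : X ⊕ X) : HasGaussianLaw (realCoords V φ j) Pr := hG.eval j
  refine ⟨hG.iIndepFun_of_covariance_eq_zero fun j k hjk => ?_, fun j => (hGj j).aemeasurable,
    fun j => ?_⟩
  · rw [covariance_eq_sub (hGj j).memLp_two (hGj k).memLp_two, hφ.integral_realCoords, zero_mul,
      sub_zero]
    exact (hφ.integral_realCoords_mul hV j k).trans (if_neg hjk)
  · rw [(hGj j).map_eq_gaussianReal, hφ.integral_realCoords,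
      variance_of_integral_eq_zero (hGj j).aemeasurable (hφ.integral_realCoords V j)]
    simp only [sq, hφ.integral_realCoords_mul hV, if_true, Real.toNNReal_one]

/-- Diagonalizing A_0 and M_χ together gives G = B Bᵀ, so φ = B u with u standard, while the
exponent becomes a diagonal form in u. As B is real, it acts separately on real and imaginary parts.
-/
theorem MassGap.exists_standard_coordinates (hM : M.MassGap) (hφ : M.IsGaussianField φ Pr)
    {χ : X → ℝ} (hχ : ∀ x, 0 ≤ χ x) :
    ∃ (B : Matrix X X ℝ) (d : X → ℝ) (u : X ⊕ X → Ω → ℝ), (∀ i, 0 ≤ d i) ∧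
      iIndepFun u Pr ∧ (∀ j, AEMeasurable (u j) Pr) ∧ (∀ j, Pr.map (u j) = gaussianReal 0 1) ∧
      (∀ ω x, (φ ω x).re = ∑ i, B x i * u (Sum.inl i) ω) ∧
      (∀ ω x, (φ ω x).im = ∑ i, B x i * u (Sum.inr i) ω) ∧
      (∀ ω, ∑ x, χ x * ‖φ ω x‖ ^ 2
        = ∑ i, d i * (u (Sum.inl i) ω ^ 2 + u (Sum.inr i) ω ^ 2)) ∧
      (∀ x y, (M.killedLaplacian χ)⁻¹ x y = ∑ i, B x i * B y i * (1 + d i)⁻¹) ∧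
      ∏ i, (1 + d i)⁻¹ = (M.killedLaplacian 0).det / (M.killedLaplacian χ).det := by
  have hH0 := hM.posDef_killedLaplacian (θ := 0) fun _ => le_rfl
  have hHχ := hM.posDef_killedLaplacian hχ
  obtain ⟨B, d, hB, h1, hd⟩ := hH0.exists_simultaneous_diagonalization
    (Matrix.isHermitian_diagonal χ)
  have hd0 (i : X) : 0 ≤ d i := by
    have h := (Matrix.PosSemidef.diagonal hχ).conjTranspose_mul_mul_same B
    rw [Matrix.conjTranspose_eq_transpose_of_trivial, hd] at h
    exact Matrix.posSemidef_diagonal_iff.1 h i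
  have hdχ : B.transpose * M.killedLaplacian χ * B = Matrix.diagonal fun i => 1 + d i := by
    rw [M.killedLaplacian_eq_add χ, Matrix.mul_add, Matrix.add_mul, h1, hd, ← Matrix.diagonal_one,
      Matrix.diagonal_add]
  have hG : M.green = B * B.transpose := by
    rw [← Matrix.diagonal_one] at h1
    rw [M.green_eq, Matrix.inv_eq_of_transpose_mul_mul_eq_diagonal hB (fun _ => one_ne_zero) h1]
    simp
  have hV : B⁻¹ * M.green * B⁻¹.transpose = 1 := by
    rw [hG, ← Matrix.mul_assoc, Matrix.nonsing_inv_mul _ hB, Matrix.one_mul, ← Matrix.transpose_mul,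
      Matrix.nonsing_inv_mul _ hB, Matrix.transpose_one]
  obtain ⟨hu, hm, hlaw⟩ := hφ.realCoords_standard hV
  have hφB (ω : Ω) (x : X) : φ ω x = ∑ i, (B x i : ℂ) * linearImage B⁻¹ φ i ω := by
    simp only [linearImage, Finset.mul_sum]
    rw [Finset.sum_comm, Finset.sum_eq_single x]
    · have h := congrFun (congrFun (Matrix.mul_nonsing_inv B hB) x) x
      rw [Matrix.mul_apply, Matrix.one_apply_eq] at h
      simp only [← mul_assoc, ← Finset.sum_mul, ← Complex.ofReal_mul, ← Complex.ofReal_sum]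
      rw [h, Complex.ofReal_one, one_mul]
    · intro y _ hy
      have h := congrFun (congrFun (Matrix.mul_nonsing_inv B hB) x) y
      rw [Matrix.mul_apply, Matrix.one_apply_ne hy.symm] at h
      simp only [← mul_assoc, ← Finset.sum_mul, ← Complex.ofReal_mul, ← Complex.ofReal_sum]
      rw [h, Complex.ofReal_zero, zero_mul]
    · simp
  have hre (ω : Ω) (x : X) : (φ ω x).re = ∑ i, B x i * realCoords B⁻¹ φ (Sum.inl i) ω := by
    rw [hφB, Complex.re_sum]
    simp [realCoords]
  have him (ω : Ω) (x : X) : (φ ω x).im = ∑ i, B x i * realCoords B⁻¹ φ (Sum.inr i) ω := by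
    rw [hφB, Complex.im_sum]
    simp [realCoords]
  have hquad (a : X → ℝ) : ∑ x, χ x * (∑ i, B x i * a i) ^ 2 = ∑ i, d i * a i ^ 2 := by
    have e1 : ∑ i, d i * a i ^ 2 = a ⬝ᵥ (Matrix.diagonal d).mulVec a := by
      simp only [dotProduct, Matrix.mulVec_diagonal]
      exact Finset.sum_congr rfl fun i _ => by ring
    have e2 : ∑ x, χ x * (∑ i, B x i * a i) ^ 2
        = B.mulVec a ⬝ᵥ (Matrix.diagonal χ).mulVec (B.mulVec a) := by
      simp only [dotProduct, Matrix.mulVec_diagonal]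
      exact Finset.sum_congr rfl fun x _ => by simp only [Matrix.mulVec, dotProduct]; ring
    rw [e1, e2, ← hd, ← Matrix.mulVec_mulVec, ← Matrix.mulVec_mulVec, Matrix.dotProduct_mulVec a,
      Matrix.vecMul_transpose]
  refine ⟨B, d, realCoords B⁻¹ φ, hd0, hu, hm, hlaw, hre, him, fun ω => ?_, fun x y => ?_, ?_⟩
  · have hn (x : X) : ‖φ ω x‖ ^ 2 = (φ ω x).re ^ 2 + (φ ω x).im ^ 2 := by
      rw [Complex.sq_norm, Complex.normSq_apply]
      ring
    simp only [hn, mul_add, Finset.sum_add_distrib]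
    rw [← hquad, ← hquad]
    simp only [hre, him]
  · rw [Matrix.inv_eq_of_transpose_mul_mul_eq_diagonal hB
      (fun i => (add_pos_of_pos_of_nonneg one_pos (hd0 i)).ne') hdχ, Matrix.mul_apply]
    simp only [Matrix.mul_diagonal, Matrix.transpose_apply]
    exact Finset.sum_congr rfl fun i _ => by ring
  · have e1 := congrArg Matrix.det h1
    have e2 := congrArg Matrix.det hdχ
    simp only [Matrix.det_mul, Matrix.det_transpose, Matrix.det_diagonal, Matrix.det_one] at e1 e2
    rw [Finset.prod_inv_distrib, ← e2, eq_div_iff hHχ.det_pos.ne', inv_mul_eq_div,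
      div_eq_iff (mul_ne_zero (mul_ne_zero hB.ne_zero hHχ.det_pos.ne') hB.ne_zero)]
    linear_combination -(M.killedLaplacian χ).det * e1

/-- In standard coordinates the weight is a product, each d_i occurring twice, so two square roots
combine into (1 + d_i)⁻¹. The tilted real and imaginary parts remain uncorrelated, which kills the
last integral. -/
theorem MassGap.gaussian_laplace (hM : M.MassGap) (hφ : M.IsGaussianField φ Pr)
    {χ : X → ℝ} (hχ : ∀ x, 0 ≤ χ x) (x y : X) :
    ∫ ω, Real.exp (-∑ u, χ u * (‖φ ω u‖ ^ 2 / 2)) ∂Pr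
        = (M.killedLaplacian 0).det / (M.killedLaplacian χ).det ∧
    ∫ ω, (φ ω x * conj (φ ω y) / 2).re * Real.exp (-∑ u, χ u * (‖φ ω u‖ ^ 2 / 2)) ∂Pr
        = (M.killedLaplacian 0).det / (M.killedLaplacian χ).det * (M.killedLaplacian χ)⁻¹ x y ∧
    ∫ ω, (φ ω x * conj (φ ω y) / 2).im * Real.exp (-∑ u, χ u * (‖φ ω u‖ ^ 2 / 2)) ∂Pr = 0 := by
  obtain ⟨B, d, u, hd, hu, hm, hlaw, hre, him, hq, hinv, hdet⟩ :=
    hM.exists_standard_coordinates hφ hχ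
  have : IsProbabilityMeasure Pr := hφ.gaussian.isProbabilityMeasure
  let c : X ⊕ X → ℝ := Sum.elim d d
  have hc (j : X ⊕ X) : 0 ≤ c j := by rcases j with i | i <;> exact hd i
  have hW (ω : Ω) : Real.exp (-∑ x, χ x * (‖φ ω x‖ ^ 2 / 2))
      = ∏ l, Real.exp (-(c l * u l ω ^ 2 / 2)) := by
    have h : ∑ x, χ x * (‖φ ω x‖ ^ 2 / 2) = (∑ x, χ x * ‖φ ω x‖ ^ 2) / 2 := by
      rw [Finset.sum_div]
      exact Finset.sum_congr rfl fun x _ => by ring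
    rw [← Real.exp_sum, h, hq, Fintype.sum_sum_type, Finset.sum_div, ← Finset.sum_neg_distrib,
      ← Finset.sum_add_distrib]
    congr 1
    refine Finset.sum_congr rfl fun i _ => ?_
    simp only [c, Sum.elim_inl, Sum.elim_inr]
    ring
  have hZ : ∏ l, (√(1 + c l))⁻¹ = (M.killedLaplacian 0).det / (M.killedLaplacian χ).det := by
    rw [Fintype.prod_sum_type, ← Finset.prod_mul_distrib, ← hdet]
    refine Finset.prod_congr rfl fun i _ => ?_
    simp only [c, Sum.elim_inl, Sum.elim_inr]
    rw [← mul_inv, Real.mul_self_sqrt (add_nonneg zero_le_one (hd i))]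
  set W : Ω → ℝ := fun ω => ∏ l, Real.exp (-(c l * u l ω ^ 2 / 2)) with hWdef
  have hWm : AEStronglyMeasurable W Pr :=
    (Finset.aemeasurable_fun_prod _ fun l _ => by have := hm l; fun_prop).aestronglyMeasurable
  have hint (j k : X ⊕ X) : Integrable (fun ω => u j ω * u k ω * W ω) Pr := by
    have hL2 (l : X ⊕ X) : MemLp (u l) 2 Pr := by
      have h := memLp_id_gaussianReal (μ := 0) (v := 1) 2
      rw [← hlaw l] at h
      exact (memLp_map_measure_iff aestronglyMeasurable_id (hm l)).1 h
    refine ((hL2 j).integrable_mul (hL2 k)).mul_bdd (c := 1) hWm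
      (Filter.Eventually.of_forall fun ω => ?_)
    rw [Real.norm_of_nonneg (Finset.prod_nonneg fun l _ => (Real.exp_pos _).le)]
    refine Finset.prod_le_one (fun l _ => (Real.exp_pos _).le) fun l _ => ?_
    exact Real.exp_le_one_iff.2 (neg_nonpos.2 (by have := hc l; positivity))
  have hsum (f g : X → X ⊕ X) (a b : X) :
      Integrable (fun ω => (∑ i, B a i * u (f i) ω) * (∑ i, B b i * u (g i) ω) * W ω) Pr ∧
      ∫ ω, (∑ i, B a i * u (f i) ω) * (∑ i, B b i * u (g i) ω) * W ω ∂Pr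
        = ∑ i, ∑ j, B a i * B b j * ((if f i = g j then (1 + c (f i))⁻¹ else 0)
          * ∏ l, (√(1 + c l))⁻¹) := by
    have e (ω : Ω) : (∑ i, B a i * u (f i) ω) * (∑ i, B b i * u (g i) ω) * W ω
        = ∑ i, ∑ j, B a i * B b j * (u (f i) ω * u (g j) ω * W ω) := by
      rw [Finset.sum_mul_sum, Finset.sum_mul]
      refine Finset.sum_congr rfl fun i _ => ?_
      rw [Finset.sum_mul]
      exact Finset.sum_congr rfl fun j _ => by ring
    have i1 (i j : X) : Integrable (fun ω => B a i * B b j * (u (f i) ω * u (g j) ω * W ω)) Pr :=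
      (hint _ _).const_mul _
    have i2 (i : X) : Integrable (fun ω => ∑ j, B a i * B b j * (u (f i) ω * u (g j) ω * W ω)) Pr :=
      integrable_finsetSum _ fun j _ => i1 i j
    simp only [e]
    refine ⟨integrable_finsetSum _ fun i _ => i2 i, ?_⟩
    rw [integral_finsetSum _ fun i _ => i2 i]
    refine Finset.sum_congr rfl fun i _ => ?_
    rw [integral_finsetSum _ fun j _ => i1 i j]
    refine Finset.sum_congr rfl fun j _ => ?_
    rw [integral_const_mul, integral_mul_mul_prod_exp hu hm hlaw hc]
  have hdiag (f : X → X ⊕ X) (hf : Function.Injective f) (hcf : ∀ i, c (f i) = d i) (a b : X) :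
      ∑ i, ∑ j, B a i * B b j * ((if f i = f j then (1 + c (f i))⁻¹ else 0)
          * ∏ l, (√(1 + c l))⁻¹)
        = (M.killedLaplacian 0).det / (M.killedLaplacian χ).det * (M.killedLaplacian χ)⁻¹ a b := by
    rw [hZ, hinv, Finset.mul_sum]
    refine Finset.sum_congr rfl fun i _ => ?_
    rw [Finset.sum_eq_single i]
    · rw [if_pos rfl, hcf]
      ring
    · intro j _ hj
      rw [if_neg fun h => hj (hf h).symm]
      ring
    · simp
  have hoff (a b : X) : ∑ i, ∑ j, B a i * B b j *
      ((if (Sum.inr i : X ⊕ X) = Sum.inl j then (1 + c (Sum.inr i))⁻¹ else 0)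
        * ∏ l, (√(1 + c l))⁻¹) = 0 := by simp
  simp only [hW]
  refine ⟨(integral_prod_exp hu hm hlaw hc).trans hZ, ?_, ?_⟩
  · have e (ω : Ω) : (φ ω x * conj (φ ω y) / 2).re * W ω
        = 1 / 2 * ((φ ω x).re * (φ ω y).re * W ω) + 1 / 2 * ((φ ω x).im * (φ ω y).im * W ω) := by
      have : (φ ω x * conj (φ ω y) / 2).re
          = 1 / 2 * ((φ ω x).re * (φ ω y).re + (φ ω x).im * (φ ω y).im) := by
        rw [Complex.div_ofNat_re, Complex.mul_re, Complex.conj_re, Complex.conj_im]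
        ring
      rw [this]
      ring
    have h1 := hsum Sum.inl Sum.inl x y
    have h2 := hsum Sum.inr Sum.inr x y
    simp only [hre, him] at e
    change ∫ ω, (φ ω x * conj (φ ω y) / 2).re * W ω ∂Pr = _
    simp only [e]
    rw [integral_add (h1.1.const_mul _) (h2.1.const_mul _), integral_const_mul, integral_const_mul,
      h1.2, h2.2, hdiag _ Sum.inl_injective fun _ => rfl, hdiag _ Sum.inr_injective fun _ => rfl]
    ring
  · have e (ω : Ω) : (φ ω x * conj (φ ω y) / 2).im * W ω
        = 1 / 2 * ((φ ω x).im * (φ ω y).re * W ω) - 1 / 2 * ((φ ω y).im * (φ ω x).re * W ω) := by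
      have : (φ ω x * conj (φ ω y) / 2).im
          = 1 / 2 * ((φ ω x).im * (φ ω y).re - (φ ω y).im * (φ ω x).re) := by
        rw [Complex.div_ofNat_im, Complex.mul_im, Complex.conj_re, Complex.conj_im]
        ring
      rw [this]
      ring
    have h1 := hsum Sum.inr Sum.inl x y
    have h2 := hsum Sum.inr Sum.inl y x
    simp only [hre, him] at e
    change ∫ ω, (φ ω x * conj (φ ω y) / 2).im * W ω ∂Pr = _
    simp only [e]
    rw [integral_sub (h1.1.const_mul _) (h2.1.const_mul _), integral_const_mul, integral_const_mul,
      h1.2, h2.2, hoff, hoff]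
    ring

end SymmetricChain

/-! ### Signed densities -/

section SignedDensity

variable {X Ω : Type*} [Fintype X] [MeasurableSpace Ω] {Pr : Measure Ω}

theorem expNeg_sum_mul_ofReal {χ : X → ℝ≥0} {a : X → ℝ} (ha : ∀ x, 0 ≤ a x) :
    expNeg (∑ x, (χ x : ℝ≥0∞) * ENNReal.ofReal (a x))
      = ENNReal.ofReal (Real.exp (-∑ x, (χ x : ℝ) * a x)) := by
  rw [← expNeg_ofReal (Finset.sum_nonneg fun x _ => mul_nonneg (χ x).coe_nonneg (ha x)),
    ENNReal.ofReal_sum_of_nonneg fun x _ => mul_nonneg (χ x).coe_nonneg (ha x)]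
  simp only [ENNReal.ofReal_mul (NNReal.coe_nonneg _), ENNReal.ofReal_coe_nnreal]

/-- The image under `Z` of the measure with density the positive part of `f`. -/
def posImage (Pr : Measure Ω) (Z : Ω → X → ℝ≥0∞) (f : Ω → ℝ) : Measure (X → ℝ≥0∞) :=
  (Pr.withDensity fun ω => ENNReal.ofReal (f ω)).map Z

omit [Fintype X] in
theorem isFiniteMeasure_posImage {f : Ω → ℝ} (hf : Integrable f Pr) (Z : Ω → X → ℝ≥0∞) :
    IsFiniteMeasure (posImage Pr Z f) := by
  have : IsFiniteMeasure (Pr.withDensity fun ω => ENNReal.ofReal (f ω)) :=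
    isFiniteMeasure_withDensity_ofReal hf.2
  unfold posImage
  infer_instance

/-- The image of the signed measure f · Pr is identified with ν by moving its negative part to the
other side, so that uniqueness is only needed for finite positive measures. -/
theorem posImage_eq_add {a : Ω → X → ℝ} (ha : ∀ x, AEMeasurable (fun ω => a ω x) Pr)
    (ha0 : ∀ ω x, 0 ≤ a ω x) {f : Ω → ℝ} (hf : Integrable f Pr) {ν : Measure (X → ℝ≥0∞)}
    [IsFiniteMeasure ν]
    (h : ∀ χ : X → ℝ≥0, ∫ ω, f ω * Real.exp (-∑ x, (χ x : ℝ) * a ω x) ∂Pr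
      = (∫⁻ z, expNeg (∑ x, (χ x : ℝ≥0∞) * z x) ∂ν).toReal) :
    posImage Pr (fun ω x => ENNReal.ofReal (a ω x)) f
      = posImage Pr (fun ω x => ENNReal.ofReal (a ω x)) (fun ω => -f ω) + ν := by
  have hZ : AEMeasurable (fun ω x => ENNReal.ofReal (a ω x)) Pr :=
    aemeasurable_pi_lambda _ fun x => (ha x).ennreal_ofReal
  have := isFiniteMeasure_posImage hf fun ω x => ENNReal.ofReal (a ω x)
  have := isFiniteMeasure_posImage hf.neg fun ω x => ENNReal.ofReal (a ω x)
  have hm (χ : X → ℝ≥0) : Measurable fun z : X → ℝ≥0∞ => expNeg (∑ x, (χ x : ℝ≥0∞) * z x) :=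
    measurable_expNeg.comp (continuous_linearForm χ).measurable
  have hκ (χ : X → ℝ≥0) {g : Ω → ℝ} (hg : AEMeasurable g Pr) :
      ∫⁻ z, expNeg (∑ x, (χ x : ℝ≥0∞) * z x) ∂(posImage Pr (fun ω x => ENNReal.ofReal (a ω x)) g)
        = ∫⁻ ω, ENNReal.ofReal (g ω * Real.exp (-∑ x, (χ x : ℝ) * a ω x)) ∂Pr := by
    have hmZ : AEMeasurable (fun ω => expNeg (∑ x, (χ x : ℝ≥0∞) * ENNReal.ofReal (a ω x))) Pr :=
      (hm χ).comp_aemeasurable hZ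
    rw [posImage, lintegral_map' (hm χ).aemeasurable
      (hZ.mono_ac (withDensity_absolutelyContinuous _ _)),
      lintegral_withDensity_eq_lintegral_mul₀ hg.ennreal_ofReal hmZ]
    refine lintegral_congr fun ω => ?_
    rw [Pi.mul_apply, expNeg_sum_mul_ofReal (ha0 ω), ENNReal.ofReal_mul' (Real.exp_pos _).le]
  refine ext_of_lintegral_expNeg fun χ => ?_
  rw [lintegral_add_measure, hκ χ hf.1.aemeasurable, hκ χ (g := fun ω => -f ω) hf.1.aemeasurable.neg]
  have he : AEStronglyMeasurable (fun ω => Real.exp (-∑ x, (χ x : ℝ) * a ω x)) Pr :=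
    (Real.measurable_exp.comp_aemeasurable (Finset.aemeasurable_fun_sum _ fun x _ =>
      (ha x).const_mul _).neg).aestronglyMeasurable
  have hint : Integrable (fun ω => f ω * Real.exp (-∑ x, (χ x : ℝ) * a ω x)) Pr := by
    refine hf.mul_bdd (c := 1) he (Filter.Eventually.of_forall fun ω => ?_)
    rw [Real.norm_of_nonneg (Real.exp_pos _).le]
    exact Real.exp_le_one_iff.2 (neg_nonpos.2
      (Finset.sum_nonneg fun x _ => mul_nonneg (χ x).coe_nonneg (ha0 ω x)))
  have hχ := h χ
  rw [integral_eq_lintegral_pos_part_sub_lintegral_neg_part hint] at hχ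
  have hp := hint.lintegral_lt_top.ne
  have hn := hint.neg.lintegral_lt_top.ne
  have hν : ∫⁻ z, expNeg (∑ x, (χ x : ℝ≥0∞) * z x) ∂ν ≠ ∞ := by
    refine ne_top_of_le_ne_top (measure_ne_top ν Set.univ) ?_
    rw [← lintegral_one]
    exact lintegral_mono fun z => expNeg_le_one _
  simp only [Pi.neg_apply, neg_mul] at hn ⊢
  rw [← ENNReal.toReal_eq_toReal_iff' hp (ENNReal.add_ne_top.2 ⟨hn, hν⟩),
    ENNReal.toReal_add hn hν]
  linarith

omit [Fintype X] in
theorem integral_smul_comp_eq_integral {Z : Ω → X → ℝ≥0∞} (hZ : AEMeasurable Z Pr) {f : Ω → ℝ}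
    (hf : AEMeasurable f Pr) {ν : Measure (X → ℝ≥0∞)}
    (h : posImage Pr Z f = posImage Pr Z (fun ω => -f ω) + ν) {F : (X → ℝ≥0∞) → ℂ}
    (hF : Measurable F) (hint : Integrable (fun ω => (f ω : ℂ) * F (Z ω)) Pr) :
    Integrable F ν ∧ ∫ ω, (f ω : ℂ) * F (Z ω) ∂Pr = ∫ z, F z ∂ν := by
  have hFZ : AEStronglyMeasurable (fun ω => F (Z ω)) Pr :=
    (hF.comp_aemeasurable hZ).aestronglyMeasurable
  have key {g : Ω → ℝ} (hg : AEMeasurable g Pr) (hgf : ∀ ω, |g ω| = |f ω|) :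
      Integrable (fun ω => ((max (g ω) 0 : ℝ) : ℂ) * F (Z ω)) Pr ∧
      Integrable F (posImage Pr Z g) ∧
      ∫ z, F z ∂(posImage Pr Z g) = ∫ ω, ((max (g ω) 0 : ℝ) : ℂ) * F (Z ω) ∂Pr := by
    have hZ' : AEMeasurable Z (Pr.withDensity fun ω => ENNReal.ofReal (g ω)) :=
      hZ.mono_ac (withDensity_absolutelyContinuous _ _)
    have hI : Integrable (fun ω => ((max (g ω) 0 : ℝ) : ℂ) * F (Z ω)) Pr := by
      refine hint.mono ((Complex.measurable_ofReal.comp_aemeasurable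
        (hg.max aemeasurable_const)).aestronglyMeasurable.mul hFZ)
        (Filter.Eventually.of_forall fun ω => ?_)
      rw [norm_mul, norm_mul, Complex.norm_real, Complex.norm_real, Real.norm_eq_abs,
        Real.norm_eq_abs, ← hgf]
      refine mul_le_mul_of_nonneg_right ?_ (norm_nonneg _)
      rw [abs_of_nonneg (le_max_right _ _)]
      exact max_le (le_abs_self _) (abs_nonneg _)
    refine ⟨hI, ?_, ?_⟩
    · rw [posImage, integrable_map_measure hF.aestronglyMeasurable hZ',
        integrable_withDensity_iff_integrable_smul₀' hg.ennreal_ofReal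
          (Filter.Eventually.of_forall fun _ => ENNReal.ofReal_lt_top)]
      refine hI.congr (Filter.Eventually.of_forall fun ω => ?_)
      simp [ENNReal.toReal_ofReal']
    · rw [posImage, integral_map hZ' hF.aestronglyMeasurable,
        integral_withDensity_eq_integral_toReal_smul₀ hg.ennreal_ofReal
          (Filter.Eventually.of_forall fun _ => ENNReal.ofReal_lt_top)]
      refine integral_congr_ae (Filter.Eventually.of_forall fun ω => ?_)
      simp [ENNReal.toReal_ofReal']
  obtain ⟨p1, p2, p3⟩ := key hf fun _ => rfl
  obtain ⟨n1, n2, n3⟩ := key (g := fun ω => -f ω) hf.neg fun _ => abs_neg _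
  -- The measure ν is dominated by the image of the positive part, so integrability on the Gaussian
  -- side carries over to it.
  have hν : Integrable F ν := p2.mono_measure (by rw [h]; exact Measure.le_add_left le_rfl)
  refine ⟨hν, ?_⟩
  have hadd := congrArg (fun m => ∫ z, F z ∂m) h
  simp only [integral_add_measure n2 hν, p3, n3] at hadd
  rw [← sub_eq_iff_eq_add', ← integral_sub p1 n1] at hadd
  rw [← hadd]
  refine integral_congr_ae (Filter.Eventually.of_forall fun ω => ?_)
  simp only
  rw [← sub_mul, ← Complex.ofReal_sub]
  congr 2
  rcases le_total 0 (f ω) with h0 | h0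
  · rw [max_eq_left h0, max_eq_right (neg_nonpos.2 h0), sub_zero]
  · rw [max_eq_right h0, max_eq_left (neg_nonneg.2 h0)]
    ring

end SignedDensity

/-! ### The isomorphism theorem -/

namespace SymmetricChain

variable {X : Type*} [Fintype X] {M : SymmetricChain X}
  {Ω : Type*} [MeasurableSpace Ω] {Pr : Measure Ω} {ℒ : Ω → Measure (Loop X)}

theorem measurable_soupOccupation (hℒ : Measurable ℒ) :
    Measurable fun ω => M.soupOccupation (ℒ ω) :=
  measurable_pi_lambda _ fun x =>
    (Measure.measurable_lintegral (M.measurable_loopOccupation x)).comp hℒ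

variable [DecidableEq X]

theorem MassGap.lintegral_soupOccupation [IsProbabilityMeasure Pr] (hM : M.MassGap)
    (hℒ : IsPoissonProcess ℒ M.loopMeasure Pr) (χ : X → ℝ≥0) :
    ∫⁻ ω, expNeg (∑ x, (χ x : ℝ≥0∞) * M.soupOccupation (ℒ ω) x) ∂Pr
      = ENNReal.ofReal ((M.killedLaplacian 0).det
          / (M.killedLaplacian fun x => (χ x : ℝ)).det) := by
  have h (ω : Ω) : ∑ x, (χ x : ℝ≥0∞) * M.soupOccupation (ℒ ω) x
      = ∫⁻ l, ∑ x, (χ x : ℝ≥0∞) * M.loopOccupation l x ∂(ℒ ω) := by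
    rw [lintegral_finsetSum _ fun x _ => (M.measurable_loopOccupation x).const_mul _]
    exact Finset.sum_congr rfl fun x _ =>
      (lintegral_const_mul _ (M.measurable_loopOccupation x)).symm
  simp only [h]
  rw [hℒ.lintegral_expNeg (Finset.measurable_fun_sum _ fun x _ =>
    (M.measurable_loopOccupation x).const_mul _),
    ← hM.expNeg_lintegral_loopMeasure fun x => (χ x).coe_nonneg]
  simp only [ENNReal.ofReal_coe_nnreal]

/-- Column y of the inverse solves A_θ v = δ_y, and the maximum principle applies to it. -/
theorem MassGap.killedLaplacian_inv_nonneg (hM : M.MassGap) {θ : X → ℝ} (hθ : ∀ x, 0 ≤ θ x)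
    (x y : X) : 0 ≤ (M.killedLaplacian θ)⁻¹ x y := by
  refine hM.nonneg_of_killedLaplacian_mulVec_nonneg hθ
    (v := fun x => (M.killedLaplacian θ)⁻¹ x y) (fun z => ?_) x
  have h := congrFun (congrFun (Matrix.mul_nonsing_inv (M.killedLaplacian θ)
    (hM.posDef_killedLaplacian hθ).det_pos.ne'.isUnit) z) y
  rw [Matrix.mul_apply] at h
  rw [Matrix.mulVec, dotProduct, h, Matrix.one_apply]
  split_ifs <;> simp

theorem MassGap.lintegral_prod (hM : M.MassGap) [IsProbabilityMeasure Pr]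
    (hℒ : IsPoissonProcess ℒ M.loopMeasure Pr) (x y : X) (χ : X → ℝ≥0) :
    ∫⁻ p, expNeg (∑ u, (χ u : ℝ≥0∞) * (M.soupOccupation (ℒ p.2) + M.pathOccupation p.1) u)
        ∂((M.bridgeMeasure x y).prod Pr)
      = ENNReal.ofReal ((M.killedLaplacian 0).det / (M.killedLaplacian fun x => (χ x : ℝ)).det
          * (M.killedLaplacian fun x => (χ x : ℝ))⁻¹ x y) := by
  have := hM.isFiniteMeasure_bridgeMeasure x y
  have h1 : Measurable fun γ => expNeg (∑ u, (χ u : ℝ≥0∞) * M.pathOccupation γ u) :=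
    measurable_expNeg.comp (Finset.measurable_fun_sum _ fun u _ =>
      (M.measurable_pathOccupation u).const_mul _)
  have h2 : Measurable fun ω => expNeg (∑ u, (χ u : ℝ≥0∞) * M.soupOccupation (ℒ ω) u) :=
    measurable_expNeg.comp ((continuous_linearForm χ).measurable.comp
      (measurable_soupOccupation hℒ.measurable))
  have h3 : ∫⁻ γ, expNeg (∑ u, (χ u : ℝ≥0∞) * M.pathOccupation γ u) ∂(M.bridgeMeasure x y)
      = ENNReal.ofReal ((M.killedLaplacian fun x => (χ x : ℝ))⁻¹ x y) := by
    rw [← hM.lintegral_bridgeMeasure fun x => (χ x).coe_nonneg]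
    simp only [ENNReal.ofReal_coe_nnreal]
  simp only [Pi.add_apply, mul_add, Finset.sum_add_distrib, expNeg_add,
    mul_comm (expNeg (∑ u, (χ u : ℝ≥0∞) * M.soupOccupation _ u))]
  rw [lintegral_prod_mul h1.aemeasurable h2.aemeasurable, h3, hM.lintegral_soupOccupation hℒ,
    mul_comm, ENNReal.ofReal_mul' (hM.killedLaplacian_inv_nonneg (fun x => (χ x).coe_nonneg) x y)]

end SymmetricChain

end

theorem mainTheorem1 {X : Type*} [Fintype X] [DecidableEq X] (M : SymmetricChain X)
    (hM : M.MassGap)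
    {Ω : Type*} [MeasurableSpace Ω] (Pr : Measure Ω) [IsProbabilityMeasure Pr]
    (ℒ : Ω → Measure (Loop X)) (hℒ : IsPoissonProcess ℒ M.loopMeasure Pr)
    {Ω' : Type*} [MeasurableSpace Ω'] (Pr' : Measure Ω') [IsProbabilityMeasure Pr']
    (φ : Ω' → X → ℂ) (hφ : M.IsGaussianField φ Pr') :
    IdentDistrib (fun ω => M.soupOccupation (ℒ ω))
        (fun ω' (x : X) => ENNReal.ofReal (‖φ ω' x‖ ^ 2 / 2)) Pr Pr' ∧
      ∀ (x y : X) (F : (X → ℝ≥0∞) → ℂ), Measurable F →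
        Integrable (fun ω' => φ ω' x * conj (φ ω' y) / 2 *
          F (fun u => ENNReal.ofReal (‖φ ω' u‖ ^ 2 / 2))) Pr' →
        Integrable (fun p : ChainPath X × Ω =>
            F (M.soupOccupation (ℒ p.2) + M.pathOccupation p.1)) ((M.bridgeMeasure x y).prod Pr) ∧
          ∫ ω', φ ω' x * conj (φ ω' y) / 2 *
              F (fun u => ENNReal.ofReal (‖φ ω' u‖ ^ 2 / 2)) ∂Pr' =
            ∫ γ, ∫ ω, F (M.soupOccupation (ℒ ω) + M.pathOccupation γ) ∂Pr
              ∂(M.bridgeMeasure x y) := by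
  have hφm (x : X) : AEMeasurable (fun ω' => φ ω' x) Pr' := (hφ.hasGaussianLaw_eval x).aemeasurable
  have ha (x : X) : AEMeasurable (fun ω' => ‖φ ω' x‖ ^ 2 / 2) Pr' := by
    have := hφm x
    fun_prop
  have ha0 (ω' : Ω') (x : X) : 0 ≤ ‖φ ω' x‖ ^ 2 / 2 := by positivity
  have hZ : AEMeasurable (fun ω' (x : X) => ENNReal.ofReal (‖φ ω' x‖ ^ 2 / 2)) Pr' :=
    aemeasurable_pi_lambda _ fun x => (ha x).ennreal_ofReal
  have hS : Measurable fun ω => M.soupOccupation (ℒ ω) :=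
    SymmetricChain.measurable_soupOccupation hℒ.measurable
  have hm (χ : X → ℝ≥0) : Measurable fun z : X → ℝ≥0∞ => expNeg (∑ x, (χ x : ℝ≥0∞) * z x) :=
    measurable_expNeg.comp (continuous_linearForm χ).measurable
  refine ⟨⟨hS.aemeasurable, hZ, ?_⟩, fun x y F hF hint => ?_⟩
  · have := Measure.isProbabilityMeasure_map (μ := Pr) hS.aemeasurable
    have := Measure.isProbabilityMeasure_map hZ
    refine ext_of_lintegral_expNeg fun χ => ?_
    rw [lintegral_map (hm χ) hS, lintegral_map' (hm χ).aemeasurable hZ,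
      hM.lintegral_soupOccupation hℒ]
    simp only [expNeg_sum_mul_ofReal (ha0 _)]
    -- `MassGap.gaussian_laplace` takes a pair of points as arguments, so the empty state space is
    -- settled separately.
    rcases isEmpty_or_nonempty X with hX | ⟨⟨x⟩⟩
    · simp
    rw [← (hM.gaussian_laplace hφ (fun x => (χ x).coe_nonneg) x x).1,
      ofReal_integral_eq_lintegral_ofReal]
    · refine Integrable.of_bound (C := 1) (Real.measurable_exp.comp_aemeasurable
        (Finset.aemeasurable_fun_sum _ fun x _ => (ha x).const_mul _).neg).aestronglyMeasurable
        (Filter.Eventually.of_forall fun ω' => ?_)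
      rw [Real.norm_of_nonneg (Real.exp_pos _).le]
      exact Real.exp_le_one_iff.2 (neg_nonpos.2
        (Finset.sum_nonneg fun x _ => mul_nonneg (χ x).coe_nonneg (ha0 ω' x)))
    · exact Filter.Eventually.of_forall fun ω' => (Real.exp_pos _).le
  · have := hM.isFiniteMeasure_bridgeMeasure x y
    let T : ChainPath X × Ω → X → ℝ≥0∞ := fun p => M.soupOccupation (ℒ p.2) + M.pathOccupation p.1
    have hT : Measurable T := (hS.comp measurable_snd).add
      ((measurable_pi_lambda _ M.measurable_pathOccupation).comp measurable_fst)
    let ψ : Ω' → ℂ := fun ω' => φ ω' x * conj (φ ω' y) / 2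
    have hψ : Integrable ψ Pr' := (hφ.integrable_mul_conj x y).div_const 2
    -- The real part of ½ φ^x φ̄^y carries the whole measure: ν is the image under T of the bridge
    -- measure times the loop law.
    have hre := posImage_eq_add ha ha0 hψ.re (ν := ((M.bridgeMeasure x y).prod Pr).map T)
      fun χ => by
        rw [lintegral_map (hm χ) hT, hM.lintegral_prod hℒ, ENNReal.toReal_ofReal]
        · exact (hM.gaussian_laplace hφ (fun x => (χ x).coe_nonneg) x y).2.1
        · exact mul_nonneg (div_nonneg (hM.posDef_killedLaplacian fun _ => le_rfl).det_pos.le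
            (hM.posDef_killedLaplacian fun x => (χ x).coe_nonneg).det_pos.le)
            (hM.killedLaplacian_inv_nonneg (fun x => (χ x).coe_nonneg) x y)
    -- All Laplace transforms weighted by the imaginary part vanish, so its positive and negative
    -- parts have the same image and it contributes nothing for any F.
    have him := posImage_eq_add ha ha0 hψ.im (ν := 0) fun χ => by
      rw [lintegral_zero_measure, ENNReal.toReal_zero]
      exact (hM.gaussian_laplace hφ (fun x => (χ x).coe_nonneg) x y).2.2
    have hFZ : AEStronglyMeasurable
        (fun ω' => F (fun u => ENNReal.ofReal (‖φ ω' u‖ ^ 2 / 2))) Pr' :=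
      (hF.comp_aemeasurable hZ).aestronglyMeasurable
    have hi (g : ℂ → ℝ) (hg : Measurable g) (hgn : ∀ z, |g z| ≤ ‖z‖) :
        Integrable (fun ω' => (g (ψ ω') : ℂ) *
          F (fun u => ENNReal.ofReal (‖φ ω' u‖ ^ 2 / 2))) Pr' := by
      refine hint.mono ((Complex.measurable_ofReal.comp_aemeasurable
        (hg.comp_aemeasurable hψ.1.aemeasurable)).aestronglyMeasurable.mul hFZ)
        (Filter.Eventually.of_forall fun ω' => ?_)
      rw [norm_mul, norm_mul, Complex.norm_real]
      exact mul_le_mul_of_nonneg_right (hgn _) (norm_nonneg _)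
    have hire := hi Complex.re Complex.measurable_re Complex.abs_re_le_norm
    have hiim := hi Complex.im Complex.measurable_im Complex.abs_im_le_norm
    obtain ⟨r1, r2⟩ := integral_smul_comp_eq_integral hZ hψ.re.1.aemeasurable hre hF hire
    obtain ⟨-, s2⟩ := integral_smul_comp_eq_integral hZ hψ.im.1.aemeasurable him hF hiim
    have hFT := (integrable_map_measure hF.aestronglyMeasurable hT.aemeasurable).1 r1
    refine ⟨hFT, ?_⟩
    rw [integral_map hT.aemeasurable hF.aestronglyMeasurable] at r2
    rw [integral_zero_measure] at s2
    have hsplit (ω' : Ω') : φ ω' x * conj (φ ω' y) / 2 *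
        F (fun u => ENNReal.ofReal (‖φ ω' u‖ ^ 2 / 2))
          = ((ψ ω').re : ℂ) * F (fun u => ENNReal.ofReal (‖φ ω' u‖ ^ 2 / 2))
            + Complex.I * (((ψ ω').im : ℂ) * F (fun u => ENNReal.ofReal (‖φ ω' u‖ ^ 2 / 2))) := by
      have h := Complex.re_add_im (ψ ω')
      calc _ = ψ ω' * F (fun u => ENNReal.ofReal (‖φ ω' u‖ ^ 2 / 2)) := rfl
        _ = _ := by
          rw [← h]
          simp only [Complex.add_re, Complex.add_im, Complex.ofReal_re, Complex.ofReal_im,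
            Complex.re_ofReal_mul, Complex.im_ofReal_mul, Complex.I_re, Complex.I_im, mul_zero,
            mul_one, add_zero, zero_add]
          ring
    simp only [hsplit]
    rw [integral_add hire (hiim.const_mul _), integral_const_mul]
    refine (congrArg₂ (fun a b => a + Complex.I * b) r2 s2).trans ?_
    rw [mul_zero, add_zero]
    exact integral_prod _ hFT
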